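/- Let $d\ge 0$ be an integer, let $a,b\in\mathbb{R}^d$ with $a_i<b_i$ for all $i$, let $Q=[a_1,b_1]\times\dots\times[a_d,b_d]$ carry Lebesgue measure $\lambda$, and let $\sigma\in\{-1,0,1\}^d$. Write $x\le_\sigma y$ if $\sigma_i x_i\le\sigma_i y_i$ for all $i$ with $\sigma_i\neq 0$ and $x_i=y_i$ for all $i$ with $\sigma_i=0$. A real function $g$ on a subset $X$ of $Q$ is called $\sigma$-monotonic if $g(x)\le g(y)$ for all $x,y\in X$ with $x\le_\sigma y$. For a continuous function $w:Q\to(0,\infty)$ let $L^2_\sigma(Q)$ be the set of those $g\in L^2(Q,w\cdot\lambda,\mathbb{R})$ a representative of which is $\sigma$-monotonic on the complement of some null set. The $\sigma$-monotonic regression $p_\sigma^w(f)$ of $f\in L^2(Q,w\cdot\lambda,\mathbb{R})$ is the unique minimizer of $g\mapsto\int_Q|f-g|^2\,w\,d\lambda$ over $g\in L^2_\sigma(Q)$. Let $\hat I=\{i:\sigma_i\ne 0\}$, $\dot I=\{i:\sigma_i=0\}$, $\hat Q=\prod_{i\in\hat I}[a_i,b_i]$ and $\hat\sigma=(\sigma_i)_{i\in\hat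 I}$; for $x\in Q$ let $\hat x=(x_i)_{i\in\hat I}$ and $\dot x=(x_i)_{i\in\dot I}$, and for $y\in\hat Q$ let $y\,\&\,\dot x$ be the point of $Q$ with $\hat I$-coordinates $y$ and $\dot I$-coordinates $\dot x$. For $y\in\hat Q$ let $\mathcal{L}(y)$ (respectively $\mathcal{U}(y)$) be the collection of all relatively open subsets of $\hat Q$ that contain $y$ and are lower (respectively upper) sets with respect to $\le_{\hat\sigma}$. For $x\in Q$ and non-null measurable $E\subset\hat Q$ put $$\operatorname{Av}_{\dot x}(E)=\frac{\int_E f(y\,\&\,\dot x)\,w(y\,\&\,\dot x)\,dy}{\int_E w(y\,\&\,\dot x)\,dy},$$ where $dy$ is Lebesgue measure on $\hat Q$ (the unit point mass if $\hat I=\emptyset$). Theorem. Suppose $f:Q\to\mathbb{R}$ and $w:Q\to(0,\infty)$ are continuous. Then the $\sigma$-monotonic regression $p_\sigma^w(f)$ exists and is unique, it has exactly one continuous and $\sigma$-monotonic representative $f_0^*:Q\to\mathbb{R}$, and for every $x\in Q$ $$\inf_{L\in\mathcal{L}(\hat x)}\ \sup_{U\in\mathcal{U}(\hat x)}\operatorname{Av}_{\dot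 x}(L\cap U)\;=\;f_0^*(x)\;=\;\sup_{U\in\mathcal{U}(\hat x)}\ \inf_{L\in\mathcal{L}(\hat x)}\operatorname{Av}_{\dot x}(L\cap U).$$ -/

import Mathlib

open MeasureTheory

noncomputable section

namespace MonReg

variable {ι : Type*}

/-- The partial order `x ≤_σ y`: `σ_i x_i ≤ σ_i y_i` for the indices with `σ_i = ± 1`, and
`x_i = y_i` for the indices with `σ_i = 0`. -/
def SigmaLE (σ : ι → SignType) (x y : ι → ℝ) : Prop :=
  ∀ i, (σ i ≠ 0 → (σ i : ℝ) * x i ≤ (σ i : ℝ) * y i) ∧ (σ i = 0 → x i = y i)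

/-- `g` is `σ`-monotonic on the cuboid `Q = Set.Icc a b = ∏ i, [a i, b i]`. -/
def SigmaMonotonic (σ : ι → SignType) {a b : ι → ℝ} (g : Set.Icc a b → ℝ) : Prop :=
  ∀ x y : Set.Icc a b, SigmaLE σ x y → g x ≤ g y

/-- `g` is `σ`-monotonic outside of some `μ`-null set. -/
def EssSigmaMonotonic (σ : ι → SignType) {a b : ι → ℝ} (μ : Measure (Set.Icc a b))
    (g : Set.Icc a b → ℝ) : Prop :=
  ∃ N : Set (Set.Icc a b), μ N = 0 ∧
    ∀ x y : Set.Icc a b, x ∉ N → y ∉ N → SigmaLE σ x y → g x ≤ g y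

/-- The set of elements of `L²(Q, μ, ℝ)` that are `σ`-monotonic up to a null set. -/
def sigmaL2 (σ : ι → SignType) {a b : ι → ℝ} (μ : Measure (Set.Icc a b)) : Set (Lp ℝ 2 μ) :=
  {g | EssSigmaMonotonic σ μ g}

/-- `p` is a closest point to `f` in the set of `σ`-monotonic elements of `L²(Q, μ, ℝ)`, in the
norm of `L²(Q, μ, ℝ)`. -/
def IsSigmaRegression (σ : ι → SignType) {a b : ι → ℝ} (μ : Measure (Set.Icc a b))
    (f p : Lp ℝ 2 μ) : Prop :=
  p ∈ sigmaL2 σ μ ∧ ∀ g ∈ sigmaL2 σ μ, ‖f - p‖ ≤ ‖f - g‖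

/-- The relatively open `σ`-lower sets of `Q` that contain `x`. -/
def lowerRO (σ : ι → SignType) {a b : ι → ℝ} (x : Set.Icc a b) : Set (Set (Set.Icc a b)) :=
  {L | (∀ y z : Set.Icc a b, SigmaLE σ y z → z ∈ L → y ∈ L) ∧ IsOpen L ∧ x ∈ L}

/-- The relatively open `σ`-upper sets of `Q` that contain `x`. -/
def upperRO (σ : ι → SignType) {a b : ι → ℝ} (x : Set.Icc a b) : Set (Set (Set.Icc a b)) :=
  {U | (∀ y z : Set.Icc a b, SigmaLE σ y z → y ∈ U → z ∈ U) ∧ IsOpen U ∧ x ∈ U}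

section Fibres

variable (σ : ι → SignType)

/-- The indices of the monotone coordinates. -/
abbrev HatIdx : Type _ := {i : ι // σ i ≠ 0}

/-- The indices of the remaining coordinates. -/
abbrev DotIdx : Type _ := {i : ι // σ i = 0}

/-- The cuboid in the monotone coordinates. -/
abbrev hatQ (a b : ι → ℝ) : Set (HatIdx σ → ℝ) :=
  Set.Icc (fun i : HatIdx σ => a i) (fun i : HatIdx σ => b i)

/-- The cuboid in the remaining coordinates. -/
abbrev dotQ (a b : ι → ℝ) : Set (DotIdx σ → ℝ) :=
  Set.Icc (fun i : DotIdx σ => a i) (fun i : DotIdx σ => b i)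

/-- The restriction of the signature to the monotone coordinates. -/
def hatSign : HatIdx σ → SignType := fun i => σ i

variable {a b : ι → ℝ}

/-- The monotone coordinates of a point of `Q`. -/
def hatPart (x : Set.Icc a b) : hatQ σ a b :=
  ⟨fun i => x.1 i, fun i => x.2.1 i, fun i => x.2.2 i⟩

/-- The remaining coordinates of a point of `Q`. -/
def dotPart (x : Set.Icc a b) : dotQ σ a b :=
  ⟨fun i => x.1 i, fun i => x.2.1 i, fun i => x.2.2 i⟩

/-- The point of `Q` with monotone coordinates `y` and remaining coordinates `z`. -/
def join (y : hatQ σ a b) (z : dotQ σ a b) : Set.Icc a b :=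
  ⟨fun i => if h : σ i = 0 then z.1 ⟨i, h⟩ else y.1 ⟨i, h⟩, by
    constructor
    · intro i
      by_cases h : σ i = 0
      · simpa [h] using z.2.1 ⟨i, h⟩
      · simpa [h] using y.2.1 ⟨i, h⟩
    · intro i
      by_cases h : σ i = 0
      · simpa [h] using z.2.2 ⟨i, h⟩
      · simpa [h] using y.2.2 ⟨i, h⟩⟩

end Fibres

variable [Fintype ι] {a b : ι → ℝ}

/-- Lebesgue measure on `Q`. -/
def leb (a b : ι → ℝ) : Measure (Set.Icc a b) :=
  (volume : Measure (ι → ℝ)).comap Subtype.val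

/-- The measure `w · λ` on `Q`, where `λ` is Lebesgue measure. -/
def weightedVolume (w : Set.Icc a b → ℝ) : Measure (Set.Icc a b) :=
  (leb a b).withDensity fun x => ENNReal.ofReal (w x)

/-- The weighted average of `f` over `E` with respect to Lebesgue measure on `Q` and the
weight `w`. -/
def wAverage (f w : Set.Icc a b → ℝ) (E : Set (Set.Icc a b)) : ℝ :=
  (∫ x in E, f x * w x ∂leb a b) / (∫ x in E, w x ∂leb a b)

/-- The inf-sup average. It is formed in the extended reals, so that infima and suprema have
their usual meaning without any boundedness requirement. -/
def infSup (σ : ι → SignType) (f w : Set.Icc a b → ℝ) (x : Set.Icc a b) : EReal :=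
  ⨅ L ∈ lowerRO σ x, ⨆ U ∈ upperRO σ x, (wAverage f w (L ∩ U) : EReal)

/-- The sup-inf average. -/
def supInf (σ : ι → SignType) (f w : Set.Icc a b → ℝ) (x : Set.Icc a b) : EReal :=
  ⨆ U ∈ upperRO σ x, ⨅ L ∈ lowerRO σ x, (wAverage f w (L ∩ U) : EReal)

/-- Continuous functions on `Q` are square-integrable with respect to `w · λ` for
continuous `w`. -/
theorem memLp_weightedVolume {f w : Set.Icc a b → ℝ} (hf : Continuous f) (hw : Continuous w) :
    MemLp f 2 (weightedVolume w) := by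
  have hvol : leb a b Set.univ < ⊤ := by
    rw [leb, comap_subtype_coe_apply measurableSet_Icc, Set.image_univ, Subtype.range_coe]
    exact isCompact_Icc.measure_lt_top
  have : IsFiniteMeasure (leb a b) := ⟨hvol⟩
  obtain ⟨B, hB⟩ := isCompact_univ.exists_bound_of_continuousOn hw.continuousOn
  obtain ⟨C, hC⟩ := isCompact_univ.exists_bound_of_continuousOn hf.continuousOn
  have : IsFiniteMeasure (weightedVolume w) := by
    unfold weightedVolume
    exact isFiniteMeasure_withDensity_ofReal
      (HasFiniteIntegral.of_bounded (C := B) (ae_of_all _ fun x => hB x (Set.mem_univ x)))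
  exact MemLp.of_bound hf.aestronglyMeasurable C (ae_of_all _ fun x => hC x (Set.mem_univ x))

end MonReg

end

namespace MonReg

/-! ### Comparison of regressions on a cuboid -/

/-! The regression is characterized by a variational inequality: `∫ (f - p) (g - p) w ≤ 0` for every
essentially monotonic `g`. The set of monotonic functions is closed under pointwise `min` and `max`
and under adding constants, so the inequality can be tested with `min p (q + η)` and `max q (p -
η)`. This gives a comparison principle, `IsBoxRegression.ae_le_add`, and from it a sup-norm
stability estimate in `f` and `w`, `IsBoxRegression.ae_le_add_of_close`.

A continuous regression is built from step functions. If `f` and `w` are constant on the cells of a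
uniform grid, then averaging a monotonic `g` over cells keeps it monotonic, so a finite-dimensional
projection yields a step regression (`exists_step_regression`). By stability, the step regressions
on finer and finer grids are uniformly Cauchy. The limit is continuous because the grids with `N +
1` and `N + 2` cells per axis have no interior node in common, so a jump at a node of one grid is
controlled by the other (`continuousOn_of_forall_step_close`).

The averaging formulas come from testing with small perturbations of `p` on `{p < t} ∩ U` and on `L
∩ {t < p}` (`infSup_eq_and_eq_supInf`). They concern single fibres, so the construction is carried
out on each fibre over the coordinates with `σ i = 0`. Stability makes the result jointly
continuous, and Fubini integrates the fibre inequalities to the inequality on the cuboid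
(`integral_fibrewise_nonpos`). Test functions need only be integrable, which is what almost every
fibre of an integrable function supplies. In `L²`, the integrated inequality gives both minimality
and uniqueness, with no appeal to closedness of the monotonic cone. -/

/-- `g` is `σ`-monotonic outside of some `μ`-null set, for functions on the whole space. -/
def EssMono {ι : Type*} (σ : ι → SignType) (μ : Measure (ι → ℝ)) (g : (ι → ℝ) → ℝ) : Prop :=
  ∃ N : Set (ι → ℝ), μ N = 0 ∧ ∀ x y, x ∉ N → y ∉ N → SigmaLE σ x y → g x ≤ g y

/-- `p` is a bounded `σ`-monotonic function on the cuboid that satisfies the variational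
inequality characterizing the regression of `f` with weight `w`. -/
structure IsBoxRegression {ι : Type*} [Fintype ι] (σ : ι → SignType) (a b : ι → ℝ)
    (f w p : (ι → ℝ) → ℝ) : Prop where
  mono : ∀ x ∈ Set.Icc a b, ∀ y ∈ Set.Icc a b, SigmaLE σ x y → p x ≤ p y
  memLp : MemLp p ⊤ (volume.restrict (Set.Icc a b))
  integral_le : ∀ g, Integrable g (volume.restrict (Set.Icc a b)) →
    EssMono σ (volume.restrict (Set.Icc a b)) g →
    ∫ x in Set.Icc a b, (f x - p x) * (g x - p x) * w x ≤ 0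

/-- The product of `s - r` with the positive part is a.e. nonnegative, since `r < s` wherever the
positive part is nonzero. Its integral is at most `0`, so it vanishes a.e., which forces the
positive part to vanish. -/
theorem ae_le_add_of_integral_mul_le {X : Type*} [MeasurableSpace X] {μ : Measure X}
    {p q r s : X → ℝ} {η : ℝ}
    (hr : Integrable (fun x => r x * max (p x - q x - η) 0) μ)
    (hs : Integrable (fun x => s x * max (p x - q x - η) 0) μ)
    (h : ∫ x, s x * max (p x - q x - η) 0 ∂μ ≤ ∫ x, r x * max (p x - q x - η) 0 ∂μ)
    (H : ∀ᵐ x ∂μ, q x + η < p x → r x < s x) : ∀ᵐ x ∂μ, p x ≤ q x + η := by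
  have hnn : 0 ≤ᵐ[μ] fun x => s x * max (p x - q x - η) 0 - r x * max (p x - q x - η) 0 := by
    filter_upwards [H] with x hx
    rcases le_or_gt (p x) (q x + η) with h1 | h1
    · simp [max_eq_right (show p x - q x - η ≤ 0 by linarith)]
    · have := hx h1
      rw [max_eq_left (by linarith)]
      simp only [Pi.zero_apply]
      nlinarith
  have h0 := (integral_eq_zero_iff_of_nonneg_ae hnn (hs.sub hr)).1
    (le_antisymm (by rw [integral_sub hs hr]; linarith) (integral_nonneg_of_ae hnn))
  filter_upwards [H, h0] with x hx hx0
  by_contra! h1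
  have := hx h1
  rw [max_eq_left (by linarith)] at hx0
  simp only [Pi.zero_apply] at hx0
  nlinarith

theorem essMono_of_mono {ι : Type*} [Fintype ι] {σ : ι → SignType} {a b : ι → ℝ}
    {g : (ι → ℝ) → ℝ}
    (hg : ∀ x ∈ Set.Icc a b, ∀ y ∈ Set.Icc a b, SigmaLE σ x y → g x ≤ g y) :
    EssMono σ (volume.restrict (Set.Icc a b)) g := by
  refine ⟨(Set.Icc a b)ᶜ, ?_, fun x y hx hy => hg x (by simpa using hx) y (by simpa using hy)⟩
  rw [Measure.restrict_apply measurableSet_Icc.compl]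
  simp

variable {ι : Type*} [Fintype ι] {σ : ι → SignType} {a b : ι → ℝ}

instance instIsFiniteMeasureRestrictIcc (a b : ι → ℝ) :
    IsFiniteMeasure ((volume : Measure (ι → ℝ)).restrict (Set.Icc a b)) :=
  ⟨by simpa using (isCompact_Icc (a := a) (b := b)).measure_lt_top⟩

theorem memLp_top_mul {X : Type*} [MeasurableSpace X] {μ : Measure X} {f g : X → ℝ}
    (hf : MemLp f ⊤ μ) (hg : MemLp g ⊤ μ) : MemLp (fun x => f x * g x) ⊤ μ :=
  hg.mul hf

theorem memLp_top_posPart_sub {X : Type*} [MeasurableSpace X] {μ : Measure X} {f g : X → ℝ}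
    [IsFiniteMeasure μ] (hf : MemLp f ⊤ μ) (hg : MemLp g ⊤ μ) (η : ℝ) :
    MemLp (fun x => max (f x - g x - η) 0) ⊤ μ :=
  ((hf.sub hg).sub (memLp_const η)).pos_part

/-- Comparison principle: the two variational inequalities give opposite signs to the residuals of
`p` and `q` integrated against the positive part of `p - q - η`. -/
theorem IsBoxRegression.ae_le_add {f w p f' w' q : (ι → ℝ) → ℝ} {η : ℝ}
    (hp : IsBoxRegression σ a b f w p) (hq : IsBoxRegression σ a b f' w' q)
    (hf : MemLp f ⊤ (volume.restrict (Set.Icc a b)))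
    (hw : MemLp w ⊤ (volume.restrict (Set.Icc a b)))
    (hf' : MemLp f' ⊤ (volume.restrict (Set.Icc a b)))
    (hw' : MemLp w' ⊤ (volume.restrict (Set.Icc a b)))
    (H : ∀ᵐ x ∂volume.restrict (Set.Icc a b),
      q x + η < p x → (f x - p x) * w x < (f' x - q x) * w' x) :
    ∀ᵐ x ∂volume.restrict (Set.Icc a b), p x ≤ q x + η := by
  have hh := memLp_top_posPart_sub hp.memLp hq.memLp η
  have hi1 : Integrable (fun x => (f x - p x) * w x * max (p x - q x - η) 0)
      (volume.restrict (Set.Icc a b)) :=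
    (memLp_top_mul (memLp_top_mul (hf.sub hp.memLp) hw) hh).integrable le_top
  have hi2 : Integrable (fun x => (f' x - q x) * w' x * max (p x - q x - η) 0)
      (volume.restrict (Set.Icc a b)) :=
    (memLp_top_mul (memLp_top_mul (hf'.sub hq.memLp) hw') hh).integrable le_top
  refine ae_le_add_of_integral_mul_le hi1 hi2 ?_ H
  -- This test function is `min p (q + η)`, and the one for `q` below is `max q (p - η)`; both
  -- inherit monotonicity from `p` and `q`.
  have h1 := hp.integral_le (fun x => p x - max (p x - q x - η) 0)
    ((hp.memLp.sub hh).integrable le_top) (essMono_of_mono fun x hx y hy hxy => by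
      have h1 := hp.mono x hx y hy hxy
      have h2 := hq.mono x hx y hy hxy
      rcases le_total (p y - q y - η) 0 with h | h <;>
      rcases le_total (p x - q x - η) 0 with h' | h' <;> simp [h, h'] <;> linarith)
  have h2 := hq.integral_le (fun x => q x + max (p x - q x - η) 0)
    ((hq.memLp.add hh).integrable le_top) (essMono_of_mono fun x hx y hy hxy => by
      have h1 := hp.mono x hx y hy hxy
      have h2 := hq.mono x hx y hy hxy
      rcases le_total (p y - q y - η) 0 with h | h <;>
      rcases le_total (p x - q x - η) 0 with h' | h' <;> simp [h, h'] <;> linarith)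
  have e1 : ∀ x, (f x - p x) * (p x - max (p x - q x - η) 0 - p x) * w x =
      -((f x - p x) * w x * max (p x - q x - η) 0) := fun x => by ring
  have e2 : ∀ x, (f' x - q x) * (q x + max (p x - q x - η) 0 - q x) * w' x =
      (f' x - q x) * w' x * max (p x - q x - η) 0 := fun x => by ring
  simp only [e1, e2, integral_neg] at h1 h2
  linarith

theorem isBoxRegression_const (w : (ι → ℝ) → ℝ) (c : ℝ) :
    IsBoxRegression σ a b (fun _ => c) w (fun _ => c) :=
  ⟨fun _ _ _ _ _ => le_rfl, memLp_const c, fun g _ _ => by simp⟩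

/-- Constants are their own regressions, so the comparison principle with `η = 0` applies against
`C` and `-C`. -/
theorem IsBoxRegression.ae_abs_le {f w p : (ι → ℝ) → ℝ} {C : ℝ}
    (hp : IsBoxRegression σ a b f w p)
    (hf : MemLp f ⊤ (volume.restrict (Set.Icc a b)))
    (hw : MemLp w ⊤ (volume.restrict (Set.Icc a b)))
    (hfC : ∀ x ∈ Set.Icc a b, |f x| ≤ C) (hw0 : ∀ x ∈ Set.Icc a b, 0 < w x) :
    ∀ᵐ x ∂volume.restrict (Set.Icc a b), |p x| ≤ C := by
  have h1 := hp.ae_le_add (isBoxRegression_const w C) (η := 0) hf hw (memLp_const C) hw (by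
    filter_upwards [ae_restrict_mem measurableSet_Icc] with x hx h
    have := abs_le.1 (hfC x hx)
    have := hw0 x hx
    nlinarith)
  have h2 := (isBoxRegression_const w (-C)).ae_le_add hp (η := 0) (memLp_const _) hw hf hw (by
    filter_upwards [ae_restrict_mem measurableSet_Icc] with x hx h
    have := abs_le.1 (hfC x hx)
    have := hw0 x hx
    nlinarith)
  filter_upwards [h1, h2] with x h1 h2
  exact abs_le.2 ⟨by linarith, by linarith⟩

/-- Where `q + η < p`, the residual `(f - p) w` is below `(f' - q) w' + (f - f') w + (f' - q) (w -
w') - η w`. Since `|q| ≤ C` a.e., the two error terms are at most `δ w` and `2 C δ'`, and `hη` lets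
`η w` absorb them. -/
theorem IsBoxRegression.ae_le_add_of_close {f w p f' w' q : (ι → ℝ) → ℝ} {C m δ δ' η : ℝ}
    (hp : IsBoxRegression σ a b f w p) (hq : IsBoxRegression σ a b f' w' q)
    (hf : MemLp f ⊤ (volume.restrict (Set.Icc a b)))
    (hw : MemLp w ⊤ (volume.restrict (Set.Icc a b)))
    (hf' : MemLp f' ⊤ (volume.restrict (Set.Icc a b)))
    (hw' : MemLp w' ⊤ (volume.restrict (Set.Icc a b)))
    (hm : 0 < m) (hwm : ∀ x ∈ Set.Icc a b, m ≤ w x) (hw0 : ∀ x ∈ Set.Icc a b, 0 < w' x)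
    (hfC : ∀ x ∈ Set.Icc a b, |f' x| ≤ C)
    (hff : ∀ x ∈ Set.Icc a b, |f x - f' x| ≤ δ) (hww : ∀ x ∈ Set.Icc a b, |w x - w' x| ≤ δ')
    (hδη : δ ≤ η) (hη : 2 * C * δ' ≤ m * (η - δ)) :
    ∀ᵐ x ∂volume.restrict (Set.Icc a b), p x ≤ q x + η := by
  refine hp.ae_le_add hq hf hw hf' hw' ?_
  filter_upwards [ae_restrict_mem measurableSet_Icc, hq.ae_abs_le hf' hw' hfC hw0]
    with x hx hqx h
  have h1 : (f x - p x) * w x < (f x - q x - η) * w x :=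
    mul_lt_mul_of_pos_right (by linarith) (hm.trans_le (hwm x hx))
  have h2 : (f x - f' x) * w x ≤ δ * w x :=
    mul_le_mul_of_nonneg_right ((abs_le.1 (hff x hx)).2) (hm.trans_le (hwm x hx)).le
  have h3 : (f' x - q x) * (w x - w' x) ≤ 2 * C * δ' := by
    refine (le_abs_self _).trans ?_
    rw [abs_mul]
    have := abs_sub (f' x) (q x)
    have := hfC x hx
    exact mul_le_mul (by linarith) (hww x hx) (abs_nonneg _)
      (by linarith [abs_nonneg (f' x)])
  have h4 : m * (η - δ) ≤ w x * (η - δ) :=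
    mul_le_mul_of_nonneg_right (hwm x hx) (by linarith)
  nlinarith

end MonReg

namespace MonReg

/-! ### Finite regressions and grids -/

/-- Scaling coordinates by `√(W k)` turns the weighted inner product into the Euclidean one. The
inequality is then the obtuse-angle criterion for the projection onto a closed convex cone. -/
theorem exists_finite_regression {S : Type*} [Fintype S] (r : S → S → Prop) (F W : S → ℝ)
    (hW : ∀ k, 0 < W k) :
    ∃ P : S → ℝ, (∀ k l, r k l → P k ≤ P l) ∧ ∀ G : S → ℝ, (∀ k l, r k l → G k ≤ G l) →
      ∑ k, (F k - P k) * (G k - P k) * W k ≤ 0 := by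
  have hs : ∀ k, 0 < √(W k) := fun k => Real.sqrt_pos.2 (hW k)
  let K : Set (EuclideanSpace ℝ S) := {v | ∀ k l, r k l → v k / √(W k) ≤ v l / √(W l)}
  have hne : K.Nonempty := ⟨0, fun k l _ => by simp⟩
  have hcl : IsClosed K := by
    simp only [K, Set.ofPred_forall]
    refine isClosed_iInter fun k => isClosed_iInter fun l => isClosed_iInter fun _ =>
      isClosed_le (by fun_prop) (by fun_prop)
  have hcv : Convex ℝ K := by
    intro u hu v hv s t hs ht _ k l hkl
    have h1 := mul_le_mul_of_nonneg_left (hu k l hkl) hs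
    have h2 := mul_le_mul_of_nonneg_left (hv k l hkl) ht
    simp only [PiLp.add_apply, PiLp.smul_apply, smul_eq_mul, add_div, mul_div_assoc]
    linarith
  obtain ⟨v, hvK, hv⟩ := exists_norm_eq_iInf_of_complete_convex hne hcl.isComplete hcv
    (WithLp.toLp 2 fun k => √(W k) * F k)
  rw [norm_eq_iInf_iff_real_inner_le_zero hcv hvK] at hv
  refine ⟨fun k => v k / √(W k), hvK, fun G hG => ?_⟩
  have h := hv (WithLp.toLp 2 fun k => √(W k) * G k) (fun k l hkl => by
    have := (hs k).ne'
    have := (hs l).ne'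
    simpa [mul_div_assoc, mul_div_cancel_left₀ _ (hs k).ne', mul_div_cancel_left₀ _ (hs l).ne']
      using hG k l hkl)
  refine le_trans (le_of_eq ?_) h
  rw [PiLp.inner_apply]
  refine Finset.sum_congr rfl fun k _ => ?_
  have h1 : √(W k) ^ 2 = W k := Real.sq_sqrt (hW k).le
  have h2 := (hs k).ne'
  simp only [PiLp.sub_apply, RCLike.inner_apply, conj_trivial]
  rw [← h1]
  simp only [Real.sqrt_sq (hs k).le]
  field_simp

/-- The index of the cell containing `s` in the partition of `[a, b]` into `n + 1` intervals of
equal length, clamped outside of `[a, b]`. -/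
noncomputable def cellIdx (n : ℕ) (a b s : ℝ) : Fin (n + 1) :=
  ⟨min ⌊(n + 1) * ((s - a) / (b - a))⌋₊ n, Nat.lt_succ_of_le (min_le_right _ _)⟩

theorem cellIdx_mono {n : ℕ} {a b s t : ℝ} (hab : a < b) (h : s ≤ t) :
    cellIdx n a b s ≤ cellIdx n a b t := by
  have : 0 < b - a := sub_pos.2 hab
  simp only [cellIdx, Fin.mk_le_mk]
  gcongr

theorem measurable_cellIdx (n : ℕ) (a b : ℝ) : Measurable (cellIdx n a b) :=
  (measurable_from_nat (f := fun k : ℕ => (⟨min k n, Nat.lt_succ_of_le (min_le_right _ _)⟩ :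
    Fin (n + 1)))).comp (Nat.measurable_floor.comp (by fun_prop))

/-- The alternative `j = n` reflects the clamp: the last cell has no upper bound, so it contains the
right endpoint. -/
theorem cellIdx_eq_iff {n : ℕ} {a b s : ℝ} (hab : a < b) (hs : a ≤ s) (j : Fin (n + 1)) :
    cellIdx n a b s = j ↔ a + j * ((b - a) / (n + 1)) ≤ s ∧
      ((j : ℕ) = n ∨ s < a + j * ((b - a) / (n + 1)) + (b - a) / (n + 1)) := by
  have h0 : 0 < b - a := sub_pos.2 hab
  have hn : (0 : ℝ) < n + 1 := by positivity
  have hy : 0 ≤ (n + 1) * ((s - a) / (b - a)) := by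
    have : 0 ≤ s - a := sub_nonneg.2 hs
    positivity
  have e1 : a + j * ((b - a) / (n + 1)) ≤ s ↔ (j : ℝ) ≤ (n + 1) * ((s - a) / (b - a)) := by
    rw [← le_sub_iff_add_le', ← mul_div_assoc, ← mul_div_assoc, div_le_iff₀ hn, le_div_iff₀ h0,
      mul_comm (s - a)]
  have e2 : s < a + j * ((b - a) / (n + 1)) + (b - a) / (n + 1) ↔
      (n + 1) * ((s - a) / (b - a)) < (j : ℕ) + 1 := by
    rw [add_assoc, ← sub_lt_iff_lt_add', ← add_one_mul, ← mul_div_assoc, ← mul_div_assoc,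
      lt_div_iff₀ hn, div_lt_iff₀ h0, mul_comm (s - a)]
  rw [e1, e2, cellIdx, Fin.ext_iff, ← Nat.le_floor_iff hy]
  have e3 : (n + 1) * ((s - a) / (b - a)) < (j : ℕ) + 1 ↔
      ⌊(n + 1) * ((s - a) / (b - a))⌋₊ < (j : ℕ) + 1 := by
    rw [Nat.floor_lt hy]; push_cast; rfl
  rw [e3]
  have := j.2
  simp only
  omega

/-! ### Uniform grids on a cuboid -/

section Grid

variable {ι : Type*}

/-- The index of the cell containing `x`. -/
noncomputable def gridIdx (n : ℕ) (a b x : ι → ℝ) : ι → Fin (n + 1) :=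
  fun i => cellIdx n (a i) (b i) (x i)

/-- The corner of the cell with index `k`. -/
noncomputable def gridPt (n : ℕ) (a b : ι → ℝ) (k : ι → Fin (n + 1)) : ι → ℝ :=
  fun i => a i + k i * ((b i - a i) / (n + 1))

/-- The box with lower corner `gridPt n a b k`. -/
def gridBox (n : ℕ) (a b : ι → ℝ) (k : ι → Fin (n + 1)) : Set (ι → ℝ) :=
  Set.univ.pi fun i => Set.Ico (gridPt n a b k i) (gridPt n a b k i + (b i - a i) / (n + 1))

variable {a b : ι → ℝ}

theorem gridIdx_sigmaLE {σ : ι → SignType} {n : ℕ} (hab : ∀ i, a i < b i) {x y : ι → ℝ}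
    (h : SigmaLE σ x y) :
    SigmaLE σ (fun i => (gridIdx n a b x i : ℝ)) (fun i => (gridIdx n a b y i : ℝ)) := by
  intro i
  refine ⟨fun hi => ?_, fun hi => by simp only [gridIdx, (h i).2 hi]⟩
  have h1 := (h i).1 hi
  rcases SignType.trichotomy (σ i) with h0 | h0 | h0
  · simp only [h0, SignType.coe_neg_one, neg_mul, one_mul, neg_le_neg_iff, Nat.cast_le,
      Fin.val_fin_le] at h1 ⊢
    exact cellIdx_mono (hab i) h1
  · exact absurd h0 hi
  · simp only [h0, SignType.coe_one, one_mul, Nat.cast_le, Fin.val_fin_le] at h1 ⊢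
    exact cellIdx_mono (hab i) h1

theorem gridPt_mem (hab : ∀ i, a i < b i) (n : ℕ) (k : ι → Fin (n + 1)) :
    gridPt n a b k ∈ Set.Icc a b := by
  have hn : (0 : ℝ) < n + 1 := by positivity
  refine ⟨fun i => ?_, fun i => ?_⟩ <;> have h0 : 0 < b i - a i := sub_pos.2 (hab i)
  · exact le_add_of_nonneg_right (by positivity)
  · have : (k i : ℝ) ≤ n + 1 := by exact_mod_cast (k i).2.le
    have h1 : (k i : ℝ) * ((b i - a i) / (n + 1)) ≤ (n + 1) * ((b i - a i) / (n + 1)) := by gcongr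
    rw [mul_div_cancel₀ _ hn.ne'] at h1
    simp only [gridPt]
    linarith

theorem gridPt_gridIdx_close (hab : ∀ i, a i < b i) (n : ℕ) {x : ι → ℝ} (hx : x ∈ Set.Icc a b)
    (i : ι) : |x i - gridPt n a b (gridIdx n a b x) i| ≤ (b i - a i) / (n + 1) := by
  have hn : (0 : ℝ) < n + 1 := by positivity
  have h := (cellIdx_eq_iff (n := n) (hab i) (hx.1 i) _).1 rfl
  rw [abs_of_nonneg (by simp only [gridPt, gridIdx]; linarith [h.1])]
  simp only [gridPt, gridIdx]
  rcases h.2 with h2 | h2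
  · have := hx.2 i
    rw [h2]
    have : (n : ℝ) * ((b i - a i) / (n + 1)) + (b i - a i) / (n + 1) = b i - a i := by
      field_simp
    linarith
  · linarith

theorem gridBox_subset (hab : ∀ i, a i < b i) (n : ℕ) (k : ι → Fin (n + 1)) :
    gridBox n a b k ⊆ Set.univ.pi fun i => Set.Ico (a i) (b i) := by
  intro x hx i _
  have hn : (0 : ℝ) < n + 1 := by positivity
  have h := hx i trivial
  refine ⟨((gridPt_mem hab n k).1 i).trans h.1, h.2.trans_le ?_⟩
  have h0 : 0 < b i - a i := sub_pos.2 (hab i)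
  have : (k i : ℝ) + 1 ≤ n + 1 := by exact_mod_cast (k i).2
  have h1 : ((k i : ℝ) + 1) * ((b i - a i) / (n + 1)) ≤ (n + 1) * ((b i - a i) / (n + 1)) := by
    gcongr
  rw [mul_div_cancel₀ _ hn.ne', add_one_mul] at h1
  simp only [gridPt]
  linarith

/-- The half-open boxes are exact translates of each other, but they miss the upper faces, which the
clamped index assigns to the last cells. Hence the restriction to the half-open cuboid. -/
theorem gridIdx_eq_iff_mem_gridBox (hab : ∀ i, a i < b i) {n : ℕ} {k : ι → Fin (n + 1)}
    {x : ι → ℝ} (hx : x ∈ Set.univ.pi fun i => Set.Ico (a i) (b i)) :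
    gridIdx n a b x = k ↔ x ∈ gridBox n a b k := by
  rw [funext_iff, gridBox, Set.mem_univ_pi]
  refine forall_congr' fun i => ?_
  have hn : (0 : ℝ) < n + 1 := by positivity
  rw [gridIdx, cellIdx_eq_iff (hab i) (hx i trivial).1, Set.mem_Ico]
  refine and_congr_right fun _ => or_iff_right_of_imp fun h => ?_
  rw [h]
  have : (n : ℝ) * ((b i - a i) / (n + 1)) + (b i - a i) / (n + 1) = b i - a i := by
    field_simp
  have := (hx i trivial).2
  linarith

theorem measurable_gridIdx (n : ℕ) (a b : ι → ℝ) : Measurable (gridIdx n a b) :=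
  measurable_pi_lambda _ fun i => (measurable_cellIdx n (a i) (b i)).comp (measurable_pi_apply i)

theorem gridBox_eq_preimage (n : ℕ) (k l : ι → Fin (n + 1)) :
    gridBox n a b k = (fun x => x + (gridPt n a b l - gridPt n a b k)) ⁻¹' gridBox n a b l := by
  ext x
  simp only [gridBox, Set.mem_univ_pi, Set.mem_preimage, Set.mem_Ico, Pi.add_apply, Pi.sub_apply]
  refine forall_congr' fun i => and_congr ?_ ?_ <;> constructor <;> intro h <;> linarith

theorem sigmaLE_gridPt_sub {σ : ι → SignType} (hab : ∀ i, a i < b i) {n : ℕ} {k l : ι → Fin (n + 1)}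
    (h : SigmaLE σ (fun i => (k i : ℝ)) (fun i => (l i : ℝ))) :
    SigmaLE σ 0 (gridPt n a b l - gridPt n a b k) := by
  intro i
  have hn : (0 : ℝ) < n + 1 := by positivity
  have h0 : 0 < b i - a i := sub_pos.2 (hab i)
  have h1 : (gridPt n a b l - gridPt n a b k) i = ((l i : ℝ) - k i) * ((b i - a i) / (n + 1)) := by
    simp only [gridPt, Pi.sub_apply]; ring
  rw [h1]
  refine ⟨fun hi => ?_, fun hi => ?_⟩
  · have := (h i).1 hi
    rw [Pi.zero_apply, mul_zero, ← mul_assoc, mul_sub]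
    exact mul_nonneg (by linarith) (by positivity)
  · have := (h i).2 hi
    simp only at this
    simp [this]

theorem gridBox_subset_Icc (hab : ∀ i, a i < b i) (n : ℕ) (k : ι → Fin (n + 1)) :
    gridBox n a b k ⊆ Set.Icc a b := fun _ hx =>
  ⟨fun i => (gridBox_subset hab n k hx i trivial).1,
    fun i => (gridBox_subset hab n k hx i trivial).2.le⟩

theorem iUnion_gridBox (hab : ∀ i, a i < b i) (n : ℕ) :
    ⋃ k, gridBox n a b k = Set.univ.pi fun i => Set.Ico (a i) (b i) := by
  ext x
  refine ⟨fun hx => ?_, fun hx => ?_⟩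
  · obtain ⟨k, hk⟩ := Set.mem_iUnion.1 hx
    exact gridBox_subset hab n k hk
  · exact Set.mem_iUnion.2 ⟨_, (gridIdx_eq_iff_mem_gridBox hab hx).1 rfl⟩

end Grid
end MonReg

namespace MonReg

/-! ### Regressions of step functions -/

variable {ι : Type*} [Fintype ι] {σ : ι → SignType} {a b : ι → ℝ}

/-- Pointwise `g x ≤ g (x + v)` as soon as neither `x` nor `x + v` is exceptional. Translation
preserves volume, so this fails only on a null subset of `s`. -/
theorem EssMono.setIntegral_le_of_translate {g : (ι → ℝ) → ℝ} {s t : Set (ι → ℝ)} {v : ι → ℝ}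
    (hg : EssMono σ (volume.restrict (Set.Icc a b)) g)
    (hi : Integrable g (volume.restrict (Set.Icc a b)))
    (hs : s ⊆ Set.Icc a b) (ht : t ⊆ Set.Icc a b)
    (hst : s = (fun x => x + v) ⁻¹' t) (hv : SigmaLE σ 0 v) :
    ∫ x in s, g x ≤ ∫ x in t, g x := by
  obtain ⟨N, hN, hmono⟩ := hg
  have hN0 : ∀ u ⊆ Set.Icc a b, (volume.restrict u) N = 0 := fun u hu =>
    le_antisymm ((Measure.restrict_mono hu le_rfl N).trans hN.le) zero_le
  have hmp := (measurePreserving_add_right (volume : Measure (ι → ℝ)) v).restrict_preimage_emb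
    (measurableEmbedding_addRight v) t
  have hN1 : (volume.restrict s) ((fun x => x + v) ⁻¹' N) = 0 := by
    rw [hst]
    exact hmp.quasiMeasurePreserving.preimage_null (hN0 t ht)
  have hg' : IntegrableOn (fun x => g (x + v)) s := by
    rw [hst]
    exact hmp.integrable_comp_of_integrable (IntegrableOn.mono_set hi ht)
  rw [← (measurePreserving_add_right (volume : Measure (ι → ℝ)) v).setIntegral_preimage_emb
    (measurableEmbedding_addRight v) g t, ← hst]
  refine integral_mono_ae (IntegrableOn.mono_set hi hs) hg' ?_
  filter_upwards [compl_mem_ae_iff.2 (hN0 s hs), compl_mem_ae_iff.2 hN1] with x hx hx'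
  refine hmono _ _ hx hx' fun i => ⟨fun hi => ?_, fun hi => ?_⟩
  · have := (hv i).1 hi
    simp only [Pi.zero_apply, Pi.add_apply, mul_zero, mul_add] at this ⊢
    linarith
  · have := (hv i).2 hi
    simp only [Pi.zero_apply, Pi.add_apply] at this ⊢
    linarith

theorem volume_real_gridBox_pos (hab : ∀ i, a i < b i) (n : ℕ) (k : ι → Fin (n + 1)) :
    0 < volume.real (gridBox n a b k) := by
  have hn : (0 : ℝ) < n + 1 := by positivity
  rw [gridBox, Measure.real, Real.volume_pi_Ico_toReal]
  · exact Finset.prod_pos fun i _ => by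
      have h0 : 0 < b i - a i := sub_pos.2 (hab i)
      rw [add_sub_cancel_left]
      positivity
  · intro i
    have h0 : 0 < b i - a i := sub_pos.2 (hab i)
    exact le_add_of_nonneg_right (by positivity)

theorem volume_real_gridBox_eq (n : ℕ) (k l : ι → Fin (n + 1)) :
    volume.real (gridBox n a b k) = volume.real (gridBox n a b l) := by
  rw [gridBox_eq_preimage n k l, Measure.real, measure_preimage_add_right, Measure.real]

theorem measurableSet_gridBox (n : ℕ) (k : ι → Fin (n + 1)) :
    MeasurableSet (gridBox n a b k) :=
  MeasurableSet.univ_pi fun _ => measurableSet_Ico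

theorem setIntegral_Icc_eq_sum_gridBox [DecidableEq ι] (hab : ∀ i, a i < b i) (n : ℕ) {F : (ι → ℝ) → ℝ}
    (hF : Integrable F (volume.restrict (Set.Icc a b))) :
    ∫ x in Set.Icc a b, F x = ∑ k, ∫ x in gridBox n a b k, F x := by
  rw [← setIntegral_congr_set (μ := (volume : Measure (ι → ℝ)))
    (Measure.univ_pi_Ico_ae_eq_Icc (μ := fun _ : ι => (volume : Measure ℝ))),
    ← iUnion_gridBox hab n,
    integral_iUnion_fintype (measurableSet_gridBox n) _
      fun k => IntegrableOn.mono_set hF (gridBox_subset_Icc hab n k)]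
  intro k l hkl
  refine Set.disjoint_left.2 fun x hk hl => hkl ?_
  rw [← (gridIdx_eq_iff_mem_gridBox hab (gridBox_subset hab n k hk)).2 hk,
    (gridIdx_eq_iff_mem_gridBox hab (gridBox_subset hab n k hk)).2 hl]

theorem memLp_top_comp_gridIdx (n : ℕ) (P : (ι → Fin (n + 1)) → ℝ) :
    MemLp (fun x => P (gridIdx n a b x)) ⊤ (volume.restrict (Set.Icc a b)) := by
  classical
  refine memLp_top_of_bound
    (((measurable_of_finite P).comp (measurable_gridIdx n a b)).aestronglyMeasurable)
    (∑ k, ‖P k‖) (ae_of_all _ fun x => ?_)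
  exact Finset.single_le_sum (f := fun k => ‖P k‖) (fun _ _ => norm_nonneg _) (Finset.mem_univ _)

/-- On a cell everything except `g` is constant, so integrating replaces `g` by its cell average.
These averages are monotonic in the index, and the finite inequality applies to them. -/
theorem exists_step_regression (hab : ∀ i, a i < b i) (σ : ι → SignType) (f w : (ι → ℝ) → ℝ)
    (hw : ∀ x ∈ Set.Icc a b, 0 < w x) (n : ℕ) :
    ∃ P : (ι → Fin (n + 1)) → ℝ,
      IsBoxRegression σ a b (fun x => f (gridPt n a b (gridIdx n a b x)))
        (fun x => w (gridPt n a b (gridIdx n a b x))) (fun x => P (gridIdx n a b x)) := by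
  classical
  obtain ⟨P, hP, hVI⟩ := exists_finite_regression
    (fun k l : ι → Fin (n + 1) => SigmaLE σ (fun i => (k i : ℝ)) (fun i => (l i : ℝ)))
    (fun k => f (gridPt n a b k)) (fun k => w (gridPt n a b k))
    (fun k => hw _ (gridPt_mem hab n k))
  refine ⟨P, fun x _ y _ hxy => hP _ _ (gridIdx_sigmaLE hab hxy), memLp_top_comp_gridIdx n P,
    fun g hgi hg => ?_⟩
  -- All boxes have the same volume, so the box with index zero provides the common normalization.
  set V := volume.real (gridBox n a b (fun _ => (0 : Fin (n + 1)))) with hV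
  have hVpos : 0 < V := volume_real_gridBox_pos hab n _
  have hG := hVI (fun k => (∫ x in gridBox n a b k, g x) / V) fun k l hkl => by
    refine div_le_div_of_nonneg_right ?_ hVpos.le
    exact hg.setIntegral_le_of_translate hgi (gridBox_subset_Icc hab n k)
      (gridBox_subset_Icc hab n l) (gridBox_eq_preimage n k l) (sigmaLE_gridPt_sub hab hkl)
  have hint : Integrable (fun x => (f (gridPt n a b (gridIdx n a b x)) - P (gridIdx n a b x)) *
      (g x - P (gridIdx n a b x)) * w (gridPt n a b (gridIdx n a b x)))
      (volume.restrict (Set.Icc a b)) := by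
    have h1 := memLp_top_comp_gridIdx (a := a) (b := b) n fun k =>
      (f (gridPt n a b k) - P k) * w (gridPt n a b k)
    have h2 := (hgi.sub ((memLp_top_comp_gridIdx (a := a) (b := b) n P).integrable
      le_top)).mul_of_top_right h1
    refine h2.congr (ae_of_all _ fun x => ?_)
    simp only [Pi.sub_apply, Pi.mul_apply]
    ring
  rw [setIntegral_Icc_eq_sum_gridBox hab n hint]
  have hcell : ∀ k, ∫ x in gridBox n a b k,
      (f (gridPt n a b (gridIdx n a b x)) - P (gridIdx n a b x)) *
      (g x - P (gridIdx n a b x)) * w (gridPt n a b (gridIdx n a b x)) =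
      V * ((f (gridPt n a b k) - P k) * ((∫ x in gridBox n a b k, g x) / V - P k) *
        w (gridPt n a b k)) := by
    intro k
    have h1 : ∫ x in gridBox n a b k,
      (f (gridPt n a b (gridIdx n a b x)) - P (gridIdx n a b x)) *
      (g x - P (gridIdx n a b x)) * w (gridPt n a b (gridIdx n a b x)) =
      ∫ x in gridBox n a b k,
        ((f (gridPt n a b k) - P k) * w (gridPt n a b k)) * (g x - P k) := by
      refine setIntegral_congr_fun (measurableSet_gridBox n k) fun x hx => ?_
      simp only [(gridIdx_eq_iff_mem_gridBox hab (gridBox_subset hab n k hx)).2 hx]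
      ring
    have hgk := IntegrableOn.mono_set hgi (gridBox_subset_Icc hab n k)
    rw [h1, integral_const_mul, integral_sub hgk (integrableOn_const
      (((measure_mono (gridBox_subset_Icc hab n k)).trans_lt isCompact_Icc.measure_lt_top).ne)),
      setIntegral_const, volume_real_gridBox_eq n k (fun _ => 0), ← hV, smul_eq_mul]
    field_simp
  simp only [hcell]
  rw [← Finset.mul_sum]
  exact mul_nonpos_of_nonneg_of_nonpos hVpos.le hG

end MonReg

namespace MonReg

/-! ### Step regressions on fine grids are close to each other -/

open Filter Topology in
theorem cellIdx_eventually_eq_nhdsGT {n : ℕ} {a b t : ℝ} (hab : a < b) (ht : a ≤ t) :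
    ∀ᶠ s in 𝓝[>] t, cellIdx n a b s = cellIdx n a b t := by
  have h := (cellIdx_eq_iff (n := n) hab ht _).1 rfl
  rcases h.2 with h2 | h2
  · filter_upwards [self_mem_nhdsWithin] with s hs
    exact (cellIdx_eq_iff hab (ht.trans (le_of_lt hs)) _).2 ⟨h.1.trans (le_of_lt hs), .inl h2⟩
  · filter_upwards [self_mem_nhdsWithin, mem_nhdsWithin_of_mem_nhds (Iio_mem_nhds h2)]
      with s hs hs2
    exact (cellIdx_eq_iff hab (ht.trans (le_of_lt hs)) _).2 ⟨h.1.trans (le_of_lt hs), .inr hs2⟩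

theorem cellIdx_right {n : ℕ} {a b : ℝ} (hab : a < b) : cellIdx n a b b = Fin.last n := by
  refine (cellIdx_eq_iff hab hab.le _).2 ⟨?_, .inl rfl⟩
  have h0 : 0 < b - a := sub_pos.2 hab
  have : (n : ℝ) * ((b - a) / (n + 1)) + (b - a) / (n + 1) = b - a := by field_simp
  have : 0 ≤ (b - a) / (n + 1) := by positivity
  simp only [Fin.val_last]
  linarith

open Filter Topology in
theorem cellIdx_eventually_eq_nhds_right {n : ℕ} {a b : ℝ} (hab : a < b) :
    ∀ᶠ s in 𝓝 b, cellIdx n a b s = cellIdx n a b b := by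
  have h0 : 0 < b - a := sub_pos.2 hab
  have h1 : (n : ℝ) * ((b - a) / (n + 1)) + (b - a) / (n + 1) = b - a := by field_simp
  have h2 : 0 < (b - a) / (n + 1) := by positivity
  filter_upwards [Ioi_mem_nhds hab,
    Ioi_mem_nhds (show a + n * ((b - a) / (n + 1)) < b by linarith)] with s hs hs2
  rw [cellIdx_right hab]
  exact (cellIdx_eq_iff hab (le_of_lt hs) _).2 ⟨le_of_lt hs2, .inl rfl⟩

-- An interval to the right of `t`, or to its left when `t = b`, suffices. Thus every pair of cell
-- indices that occurs at a point also occurs on a nonempty open box.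
open Filter Topology in
theorem exists_Ioo_cellIdx_eq (n m : ℕ) {a b t : ℝ} (hab : a < b) (ht : t ∈ Set.Icc a b) :
    ∃ l r, l < r ∧ Set.Ioo l r ⊆ Set.Icc a b ∧
      ∀ s ∈ Set.Ioo l r, cellIdx n a b s = cellIdx n a b t ∧ cellIdx m a b s = cellIdx m a b t := by
  rcases ht.2.lt_or_eq with h | rfl
  · obtain ⟨r, hr, hsub⟩ := (mem_nhdsGT_iff_exists_Ioo_subset' h).1
      (((cellIdx_eventually_eq_nhdsGT (n := n) hab ht.1).and
        (cellIdx_eventually_eq_nhdsGT (n := m) hab ht.1)).and (Ioo_mem_nhdsGT h))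
    exact ⟨t, r, hr, fun s hs => ⟨ht.1.trans hs.1.le, (hsub hs).2.2.le⟩, fun s hs => (hsub hs).1⟩
  · obtain ⟨l, hl, hsub⟩ := (mem_nhdsLT_iff_exists_Ioo_subset' hab).1
      ((((cellIdx_eventually_eq_nhds_right (n := n) hab).and
        (cellIdx_eventually_eq_nhds_right (n := m) hab)).filter_mono nhdsWithin_le_nhds).and
        (Ioo_mem_nhdsLT hab))
    exact ⟨l, t, hl, fun s hs => ⟨(hsub hs).2.1.le, hs.2.le⟩, fun s hs => (hsub hs).1⟩

open Filter Topology in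
theorem cellIdx_eventually_eq_or {n : ℕ} {a b t : ℝ} (hab : a < b) (ht : t ∈ Set.Icc a b) :
    (∀ᶠ s in 𝓝[Set.Icc a b] t, cellIdx n a b s = cellIdx n a b t) ∨
      ∃ j : ℕ, 0 < j ∧ j < n + 1 ∧ t = a + j * ((b - a) / (n + 1)) := by
  by_cases hj : ∃ j : ℕ, 0 < j ∧ j < n + 1 ∧ t = a + j * ((b - a) / (n + 1))
  · exact .inr hj
  left
  push Not at hj
  have h := (cellIdx_eq_iff (n := n) hab ht.1 _).1 rfl
  have h1 : ∀ᶠ s in 𝓝[Set.Icc a b] t,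
      a + (cellIdx n a b t : ℕ) * ((b - a) / (n + 1)) ≤ s := by
    rcases Nat.eq_zero_or_pos (cellIdx n a b t : ℕ) with h0 | h0
    · filter_upwards [self_mem_nhdsWithin] with s hs
      simpa [h0] using hs.1
    · have := lt_of_le_of_ne h.1 (hj _ h0 (cellIdx n a b t).2).symm
      filter_upwards [mem_nhdsWithin_of_mem_nhds (Ioi_mem_nhds this)] with s hs using le_of_lt hs
  rcases h.2 with h2 | h2
  · filter_upwards [self_mem_nhdsWithin, h1] with s hs hs1
    exact (cellIdx_eq_iff hab hs.1 _).2 ⟨hs1, .inl h2⟩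
  · filter_upwards [self_mem_nhdsWithin, h1, mem_nhdsWithin_of_mem_nhds (Iio_mem_nhds h2)]
      with s hs hs1 hs2
    exact (cellIdx_eq_iff hab hs.1 _).2 ⟨hs1, .inr hs2⟩

-- An index can change only at interior nodes, and the partitions into `n + 1` and `n + 2` intervals
-- share none because `n + 1` and `n + 2` are coprime.
open Filter Topology in
theorem cellIdx_eventually_eq_or_succ (n : ℕ) {a b t : ℝ} (hab : a < b) (ht : t ∈ Set.Icc a b) :
    (∀ᶠ s in 𝓝[Set.Icc a b] t, cellIdx n a b s = cellIdx n a b t) ∨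
      ∀ᶠ s in 𝓝[Set.Icc a b] t, cellIdx (n + 1) a b s = cellIdx (n + 1) a b t := by
  rcases cellIdx_eventually_eq_or (n := n) hab ht with h | ⟨j, hj0, hjn, hj⟩
  · exact .inl h
  rcases cellIdx_eventually_eq_or (n := n + 1) hab ht with h | ⟨k, hk0, hkn, hk⟩
  · exact .inr h
  exfalso
  have h0 : b - a ≠ 0 := (sub_pos.2 hab).ne'
  have h1 : (j : ℝ) * ((b - a) / (n + 1)) = k * ((b - a) / ((n + 1 : ℕ) + 1)) := by linarith
  have hn : (n : ℝ) + 1 ≠ 0 := by positivity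
  have hn' : (n : ℝ) + 1 + 1 ≠ 0 := by positivity
  push_cast at h1
  field_simp at h1
  have h2 : j * (n + 1 + 1) = (n + 1) * k := by
    have : (j : ℝ) * (n + 1 + 1) = (n + 1) * k := by linarith
    exact_mod_cast this
  -- From `j * (n + 2) = j * (n + 1) + j`, the divisor `n + 1` must divide `j`, although `0 < j < n
  -- + 1`.
  have h3 : n + 1 ∣ j := (Nat.dvd_add_right (Dvd.intro_left j rfl : n + 1 ∣ j * (n + 1))).1
    ⟨k, by linarith⟩
  exact absurd (Nat.le_of_dvd hj0 h3) (by omega)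

variable {ι : Type*} [Fintype ι] {σ : ι → SignType} {a b : ι → ℝ}

/-- A failure at one point would persist on a nonempty open box where both indices are unchanged,
hence on a set of positive measure. -/
theorem forall_le_of_ae_le_gridIdx (hab : ∀ i, a i < b i) {n m : ℕ}
    {P : (ι → Fin (n + 1)) → ℝ} {R : (ι → Fin (m + 1)) → ℝ} {η : ℝ}
    (h : ∀ᵐ x ∂volume.restrict (Set.Icc a b), P (gridIdx n a b x) ≤ R (gridIdx m a b x) + η)
    {x : ι → ℝ} (hx : x ∈ Set.Icc a b) : P (gridIdx n a b x) ≤ R (gridIdx m a b x) + η := by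
  choose l r hlr hsub heq using fun i =>
    exists_Ioo_cellIdx_eq n m (hab i) (t := x i) ⟨hx.1 i, hx.2 i⟩
  have ho : IsOpen (Set.univ.pi fun i => Set.Ioo (l i) (r i)) :=
    isOpen_set_pi Set.finite_univ fun _ _ => isOpen_Ioo
  have hne : (Set.univ.pi fun i => Set.Ioo (l i) (r i)).Nonempty :=
    Set.univ_pi_nonempty_iff.2 fun i => Set.nonempty_Ioo.2 (hlr i)
  by_contra hcon
  refine (ho.measure_pos volume hne).ne' (measure_mono_null (fun y hy => ?_)
    (ae_iff.1 ((ae_restrict_iff' measurableSet_Icc).1 h)))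
  have e1 : gridIdx n a b y = gridIdx n a b x := funext fun i => (heq i _ (hy i trivial)).1
  have e2 : gridIdx m a b y = gridIdx m a b x := funext fun i => (heq i _ (hy i trivial)).2
  simp only [Set.mem_ofPred_eq, e1, e2]
  exact fun hh => hcon (hh ⟨fun i => (hsub i (hy i trivial)).1, fun i => (hsub i (hy i trivial)).2⟩)

theorem memLp_top_of_continuousOn {f : (ι → ℝ) → ℝ} (hf : ContinuousOn f (Set.Icc a b)) :
    MemLp f ⊤ (volume.restrict (Set.Icc a b)) := by
  obtain ⟨C, hC⟩ := isCompact_Icc.exists_bound_of_continuousOn hf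
  refine memLp_top_of_bound (hf.aestronglyMeasurable measurableSet_Icc) C ?_
  filter_upwards [ae_restrict_mem measurableSet_Icc] with x hx using hC x hx

theorem exists_forall_gridPt_close (hab : ∀ i, a i < b i) {f : (ι → ℝ) → ℝ}
    (hf : ContinuousOn f (Set.Icc a b)) {ε : ℝ} (hε : 0 < ε) :
    ∃ N : ℕ, ∀ n ≥ N, ∀ x ∈ Set.Icc a b, |f (gridPt n a b (gridIdx n a b x)) - f x| ≤ ε := by
  obtain ⟨δ, hδ, h⟩ := Metric.uniformContinuousOn_iff_le.1
    (isCompact_Icc.uniformContinuousOn_of_continuous hf) ε hε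
  obtain ⟨N, hN⟩ := exists_nat_gt (‖b - a‖ / δ)
  refine ⟨N, fun n hn x hx => h _ (gridPt_mem hab n _) x hx ?_⟩
  have hn0 : (0 : ℝ) < n + 1 := by positivity
  have hn1 : (N : ℝ) ≤ n := by exact_mod_cast hn
  refine (dist_pi_le_iff hδ.le).2 fun i => ?_
  rw [dist_comm, Real.dist_eq]
  refine (gridPt_gridIdx_close hab n hx i).trans ?_
  rw [div_le_iff₀ hn0]
  have h1 : b i - a i ≤ ‖b - a‖ := (le_abs_self _).trans (norm_le_pi_norm (b - a) i)
  rw [div_lt_iff₀ hδ] at hN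
  nlinarith

theorem exists_forall_step_close (hab : ∀ i, a i < b i) {f w : (ι → ℝ) → ℝ}
    (hf : ContinuousOn f (Set.Icc a b)) (hw : ContinuousOn w (Set.Icc a b))
    (hw0 : ∀ x ∈ Set.Icc a b, 0 < w x) {P : ∀ n : ℕ, (ι → Fin (n + 1)) → ℝ}
    (hP : ∀ n, IsBoxRegression σ a b (fun x => f (gridPt n a b (gridIdx n a b x)))
        (fun x => w (gridPt n a b (gridIdx n a b x))) (fun x => P n (gridIdx n a b x)))
    {η : ℝ} (hη : 0 < η) :
    ∃ N : ℕ, ∀ n ≥ N, ∀ m ≥ N, ∀ x ∈ Set.Icc a b,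
      P n (gridIdx n a b x) ≤ P m (gridIdx m a b x) + η := by
  obtain ⟨C, hC⟩ := isCompact_Icc.exists_bound_of_continuousOn hf
  have hne : (Set.Icc a b).Nonempty := ⟨a, le_rfl, fun i => (hab i).le⟩
  obtain ⟨y, hy, hmin⟩ := isCompact_Icc.exists_isMinOn hne hw
  have hC0 : 0 ≤ C := (norm_nonneg _).trans (hC y hy)
  have hm := hw0 y hy
  set m₀ := w y
  -- Two grids are compared through `f` and `w`, so the errors double to `δ = η / 2` and `δ' = m₀ η
  -- / (4 (C + 1))`. Then `2 C δ' ≤ m₀ η / 2 = m₀ (η - δ)`; using `C + 1` avoids division by zero.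
  obtain ⟨N₁, hN₁⟩ := exists_forall_gridPt_close hab hf (show 0 < η / 4 by positivity)
  obtain ⟨N₂, hN₂⟩ := exists_forall_gridPt_close hab hw
    (show 0 < m₀ * η / (8 * (C + 1)) by positivity)
  refine ⟨max N₁ N₂, fun n hn m hm' x hx => forall_le_of_ae_le_gridIdx hab ?_ hx⟩
  refine (hP n).ae_le_add_of_close (hP m) (C := C) (m := m₀) (δ := η / 2)
    (δ' := 2 * (m₀ * η / (8 * (C + 1))))
    (memLp_top_comp_gridIdx n fun k => f (gridPt n a b k))
    (memLp_top_comp_gridIdx n fun k => w (gridPt n a b k))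
    (memLp_top_comp_gridIdx m fun k => f (gridPt m a b k))
    (memLp_top_comp_gridIdx m fun k => w (gridPt m a b k)) hm
    (fun x _ => hmin (gridPt_mem hab n _)) (fun x _ => hw0 _ (gridPt_mem hab m _))
    (fun x _ => hC _ (gridPt_mem hab m _)) (fun x hx => ?_) (fun x hx => ?_) (by linarith) ?_
  · have h1 := abs_le.1 (hN₁ n (le_of_max_le_left hn) x hx)
    have h2 := abs_le.1 (hN₁ m (le_of_max_le_left hm') x hx)
    exact abs_le.2 ⟨by linarith, by linarith⟩
  · have h1 := abs_le.1 (hN₂ n (le_of_max_le_right hn) x hx)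
    have h2 := abs_le.1 (hN₂ m (le_of_max_le_right hm') x hx)
    exact abs_le.2 ⟨by linarith, by linarith⟩
  · have : m₀ * (η - η / 2) - 2 * C * (2 * (m₀ * η / (8 * (C + 1)))) =
        m₀ * η / (2 * (C + 1)) := by
      field_simp
      ring
    have : 0 ≤ m₀ * η / (2 * (C + 1)) := by positivity
    linarith

end MonReg

namespace MonReg

/-! ### The continuous regression as a limit of step regressions -/

variable {ι : Type*} [Fintype ι] {σ : ι → SignType} {a b : ι → ℝ}

-- For `y` near `x`, each coordinate keeps its cell in the `N`-th grid or in the next one. A mixed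
-- point `u` then shares the `N`-cell of `x` and the `(N + 1)`-cell of `y`. Passing from `p x`
-- through `p u` to `p y` costs four errors of `ε / 5`.
open Filter Topology in
theorem continuousOn_of_forall_step_close (hab : ∀ i, a i < b i)
    {P : ∀ n : ℕ, (ι → Fin (n + 1)) → ℝ} {p : (ι → ℝ) → ℝ}
    (h : ∀ η > 0, ∃ N : ℕ, ∀ n ≥ N, ∀ x ∈ Set.Icc a b, |P n (gridIdx n a b x) - p x| ≤ η) :
    ContinuousOn p (Set.Icc a b) := by
  intro x hx
  rw [ContinuousWithinAt, Metric.tendsto_nhds]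
  intro ε hε
  obtain ⟨N, hN⟩ := h (ε / 5) (by positivity)
  have hev : ∀ᶠ y in 𝓝[Set.Icc a b] x, ∀ i,
      cellIdx N (a i) (b i) (y i) = cellIdx N (a i) (b i) (x i) ∨
      cellIdx (N + 1) (a i) (b i) (y i) = cellIdx (N + 1) (a i) (b i) (x i) := by
    refine eventually_all.2 fun i => ?_
    have ht : Tendsto (fun y : ι → ℝ => y i) (𝓝[Set.Icc a b] x) (𝓝[Set.Icc (a i) (b i)] (x i)) :=
      ((continuous_apply i).continuousWithinAt).tendsto_nhdsWithin
        fun y hy => ⟨hy.1 i, hy.2 i⟩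
    rcases cellIdx_eventually_eq_or_succ N (hab i) (t := x i) ⟨hx.1 i, hx.2 i⟩ with h1 | h1
    · exact (ht.eventually h1).mono fun y hy => .inl hy
    · exact (ht.eventually h1).mono fun y hy => .inr hy
  filter_upwards [hev, self_mem_nhdsWithin] with y hy hyQ
  classical
  let u : ι → ℝ := fun i =>
    if cellIdx N (a i) (b i) (y i) = cellIdx N (a i) (b i) (x i) then y i else x i
  have hu : u ∈ Set.Icc a b := by
    constructor <;> intro i <;> by_cases hi :
      cellIdx N (a i) (b i) (y i) = cellIdx N (a i) (b i) (x i) <;> simp only [u, hi, if_true,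
        if_false]
    exacts [hyQ.1 i, hx.1 i, hyQ.2 i, hx.2 i]
  have e1 : gridIdx N a b u = gridIdx N a b x := by
    funext i
    by_cases hi : cellIdx N (a i) (b i) (y i) = cellIdx N (a i) (b i) (x i) <;>
      simp [gridIdx, u, hi]
  have e2 : gridIdx (N + 1) a b u = gridIdx (N + 1) a b y := by
    funext i
    by_cases hi : cellIdx N (a i) (b i) (y i) = cellIdx N (a i) (b i) (x i)
    · simp [gridIdx, u, hi]
    · simp [gridIdx, u, hi, (hy i).resolve_left hi]
  have h1 := abs_le.1 (hN N le_rfl u hu)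
  have h2 := abs_le.1 (hN N le_rfl x hx)
  have h3 := abs_le.1 (hN (N + 1) (Nat.le_succ N) u hu)
  have h4 := abs_le.1 (hN (N + 1) (Nat.le_succ N) y hyQ)
  rw [e1] at h1
  rw [e2] at h3
  rw [Real.dist_eq, abs_lt]
  constructor <;> linarith

open Filter Topology in
/-- A continuous function on a cuboid has a continuous regression. -/
theorem exists_continuousOn_boxRegression (hab : ∀ i, a i < b i) (σ : ι → SignType)
    {f w : (ι → ℝ) → ℝ} (hf : ContinuousOn f (Set.Icc a b)) (hw : ContinuousOn w (Set.Icc a b))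
    (hw0 : ∀ x ∈ Set.Icc a b, 0 < w x) :
    ∃ p, ContinuousOn p (Set.Icc a b) ∧ IsBoxRegression σ a b f w p := by
  choose P hP using exists_step_regression hab σ f w hw0
  have hcauchy : ∀ x, x ∈ Set.Icc a b → CauchySeq fun n => P n (gridIdx n a b x) := by
    intro x hx
    refine Metric.cauchySeq_iff'.2 fun ε hε => ?_
    obtain ⟨N, hN⟩ := exists_forall_step_close hab hf hw hw0 hP (half_pos hε)
    refine ⟨N, fun n hn => ?_⟩
    have h1 := hN n hn N le_rfl x hx
    have h2 := hN N le_rfl n hn x hx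
    rw [Real.dist_eq, abs_lt]
    constructor <;> linarith
  choose! p hp using fun x hx => cauchySeq_tendsto_of_complete (hcauchy x hx)
  have hunif : ∀ η > 0, ∃ N : ℕ, ∀ n ≥ N, ∀ x ∈ Set.Icc a b,
      |P n (gridIdx n a b x) - p x| ≤ η := by
    intro η hη
    obtain ⟨N, hN⟩ := exists_forall_step_close hab hf hw hw0 hP hη
    refine ⟨N, fun n hn x hx => abs_le.2 ⟨?_, ?_⟩⟩
    · have := le_of_tendsto (hp x hx) (eventually_atTop.2 ⟨N, fun m hm => hN m hm n hn x hx⟩)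
      linarith
    · have := ge_of_tendsto (hp x hx) (b := P n (gridIdx n a b x) - η)
        (eventually_atTop.2 ⟨N, fun m hm => by linarith [hN n hn m hm x hx]⟩)
      linarith
  have hcont := continuousOn_of_forall_step_close hab hunif
  refine ⟨p, hcont, fun x hx y hy hxy => le_of_tendsto_of_tendsto' (hp x hx) (hp y hy)
    fun n => (hP n).mono x hx y hy hxy, memLp_top_of_continuousOn hcont, fun g hgi hg => ?_⟩
  obtain ⟨C, hC⟩ := isCompact_Icc.exists_bound_of_continuousOn hf
  obtain ⟨W, hW⟩ := isCompact_Icc.exists_bound_of_continuousOn hw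
  obtain ⟨B, hB⟩ := isCompact_Icc.exists_bound_of_continuousOn hcont
  -- Uniform distance at most `1` from the limit bounds the step regressions by `B + 1`, which
  -- supplies the integrable dominating function.
  obtain ⟨N, hN⟩ := hunif 1 one_pos
  have hlim := tendsto_integral_filter_of_dominated_convergence
    (μ := volume.restrict (Set.Icc a b)) (l := atTop)
    (F := fun n x => (f (gridPt n a b (gridIdx n a b x)) - P n (gridIdx n a b x)) *
      (g x - P n (gridIdx n a b x)) * w (gridPt n a b (gridIdx n a b x)))
    (f := fun x => (f x - p x) * (g x - p x) * w x)
    (fun x => (C + (B + 1)) * (|g x| + (B + 1)) * W) ?_ ?_ ?_ ?_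
  · exact le_of_tendsto hlim (Eventually.of_forall fun n => (hP n).integral_le g hgi hg)
  · refine Eventually.of_forall fun n => ?_
    exact (((memLp_top_comp_gridIdx n fun k => f (gridPt n a b k) - P n k).aestronglyMeasurable).mul
      (hgi.aestronglyMeasurable.sub (memLp_top_comp_gridIdx n (P n)).aestronglyMeasurable)).mul
      (memLp_top_comp_gridIdx n fun k => w (gridPt n a b k)).aestronglyMeasurable
  · filter_upwards [eventually_ge_atTop N] with n hn
    filter_upwards [ae_restrict_mem measurableSet_Icc] with x hx
    have h1 := hC _ (gridPt_mem hab n (gridIdx n a b x))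
    have h2 := hW _ (gridPt_mem hab n (gridIdx n a b x))
    have h3 : |P n (gridIdx n a b x)| ≤ B + 1 := by
      have h3 := abs_le.1 (hN n hn x hx)
      have h4 := abs_le.1 (hB x hx)
      exact abs_le.2 ⟨by linarith, by linarith⟩
    have h5 := abs_sub (f (gridPt n a b (gridIdx n a b x))) (P n (gridIdx n a b x))
    have h6 := abs_sub (g x) (P n (gridIdx n a b x))
    rw [Real.norm_eq_abs] at h1 h2 ⊢
    rw [abs_mul, abs_mul]
    have h7 := abs_nonneg (f (gridPt n a b (gridIdx n a b x)))
    have h8 := abs_nonneg (P n (gridIdx n a b x))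
    have h9 := abs_nonneg (g x)
    exact mul_le_mul (mul_le_mul (by linarith) (by linarith) (abs_nonneg _) (by linarith)) h2
      (abs_nonneg _) (mul_nonneg (by linarith) (by linarith))
  · exact (((hgi.abs.add (integrable_const (B + 1))).const_mul (C + (B + 1))).mul_const W)
  · filter_upwards [ae_restrict_mem measurableSet_Icc] with x hx
    have hg1 : ∀ {φ : (ι → ℝ) → ℝ}, ContinuousOn φ (Set.Icc a b) →
        Tendsto (fun n => φ (gridPt n a b (gridIdx n a b x))) atTop (𝓝 (φ x)) := by
      intro φ hφ
      refine Metric.tendsto_atTop.2 fun ε hε => ?_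
      obtain ⟨M, hM⟩ := exists_forall_gridPt_close hab hφ (half_pos hε)
      exact ⟨M, fun n hn => (hM n hn x hx).trans_lt (half_lt_self hε)⟩
    exact (((hg1 hf).sub (hp x hx)).mul ((tendsto_const_nhds).sub (hp x hx))).mul (hg1 hw)

end MonReg

namespace MonReg

/-! ### The averaging formulas -/

section Order

variable {ι : Type*}

theorem SigmaLE.neg_iff {σ : ι → SignType} {x y : ι → ℝ} :
    SigmaLE (-σ) x y ↔ SigmaLE σ y x := by
  refine forall_congr' fun i => ?_
  simp only [Pi.neg_apply, SignType.coe_neg, neg_mul, neg_le_neg_iff, ne_eq, SignType.neg_eq_zero_iff]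
  exact and_congr Iff.rfl (imp_congr_right fun _ => eq_comm)

end Order

variable {ι : Type*} [Fintype ι] {σ : ι → SignType} {a b : ι → ℝ}

instance instIsFiniteMeasureLeb (a b : ι → ℝ) : IsFiniteMeasure (leb a b) := by
  refine ⟨?_⟩
  rw [leb, comap_subtype_coe_apply measurableSet_Icc, Set.image_univ, Subtype.range_coe]
  exact isCompact_Icc.measure_lt_top

/-- The open cuboid is dense in the closed one, so every nonempty relatively open set contains a
nonempty open subset of the ambient space. -/
theorem isOpenPosMeasure_leb (hab : ∀ i, a i < b i) : (leb a b).IsOpenPosMeasure := by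
  refine ⟨fun U hU ⟨x, hx⟩ => ?_⟩
  obtain ⟨V, hV, rfl⟩ := isOpen_induced_iff.1 hU
  have hcl : x.1 ∈ closure (Set.univ.pi fun i => Set.Ioo (a i) (b i)) := by
    rw [closure_pi_set]
    exact fun i _ => by
      simp only [closure_Ioo (hab i).ne]
      exact ⟨x.2.1 i, x.2.2 i⟩
  have hne := mem_closure_iff.1 hcl V hV hx
  have ho : IsOpen (V ∩ Set.univ.pi fun i => Set.Ioo (a i) (b i)) :=
    hV.inter (isOpen_set_pi Set.finite_univ fun _ _ => isOpen_Ioo)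
  rw [leb, comap_subtype_coe_apply measurableSet_Icc]
  refine ((ho.measure_pos volume hne).trans_le (measure_mono fun y hy => ?_)).ne'
  exact ⟨⟨y, fun i => (hy.2 i trivial).1.le, fun i => (hy.2 i trivial).2.le⟩, hy.1, rfl⟩

theorem integrable_leb_of_continuous {f : Set.Icc a b → ℝ} (hf : Continuous f) :
    Integrable f (leb a b) := by
  obtain ⟨C, hC⟩ := isCompact_univ.exists_bound_of_continuousOn hf.continuousOn
  exact Integrable.of_bound hf.aestronglyMeasurable C (ae_of_all _ fun x => hC x (Set.mem_univ x))

-- Raise `p` on `{p < t} ∩ U` by `1 / (n + 1)`, capped at `t`. The result is monotonic: a point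
-- above this set lies in `U`, so it is in the set again or has `p ≥ t`. Rescaling by `n + 1` and
-- letting `n → ∞` gives the inequality.
open Filter Topology in
theorem setIntegral_lower_inter_upper_nonpos {f w p : Set.Icc a b → ℝ} (hf : Continuous f)
    (hw : Continuous w) (hp : Continuous p) (hmono : SigmaMonotonic σ p)
    (hVI : ∀ g : Set.Icc a b → ℝ, Measurable g → (∃ C, ∀ x, |g x| ≤ C) → SigmaMonotonic σ g →
      ∫ x, (f x - p x) * (g x - p x) * w x ∂leb a b ≤ 0)
    (t : ℝ) {U : Set (Set.Icc a b)} (hU : IsOpen U)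
    (hUup : ∀ y z : Set.Icc a b, SigmaLE σ y z → y ∈ U → z ∈ U) :
    ∫ x in {x | p x < t} ∩ U, (f x - p x) * w x ∂leb a b ≤ 0 := by
  classical
  have hE : MeasurableSet ({x | p x < t} ∩ U) :=
    ((isOpen_lt hp continuous_const).inter hU).measurableSet
  set E := {x | p x < t} ∩ U with hEdef
  obtain ⟨B, hB⟩ := isCompact_univ.exists_bound_of_continuousOn hp.continuousOn
  have key : ∀ n : ℕ, ∫ x in E, (f x - p x) * w x * min 1 ((n + 1) * (t - p x)) ∂leb a b ≤ 0 := by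
    intro n
    have hn : (0 : ℝ) < n + 1 := by positivity
    have hd : (0 : ℝ) < 1 / (n + 1) := by positivity
    have h := hVI (E.piecewise (fun x => min (p x + 1 / (n + 1)) t) p)
      (Measurable.piecewise hE (by fun_prop) hp.measurable)
      ⟨B + 1 / (n + 1), fun x => ?_⟩ fun x y hxy => ?_
    · have e : ∀ x, (f x - p x) * (E.piecewise (fun x => min (p x + 1 / (n + 1)) t) p x - p x) *
          w x = 1 / (n + 1) *
            E.indicator (fun x => (f x - p x) * w x * min 1 ((n + 1) * (t - p x))) x := by
        intro x
        by_cases hx : x ∈ E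
        · have : min (p x + 1 / (n + 1)) t - p x =
              1 / (n + 1) * min 1 ((n + 1) * (t - p x)) := by
            rw [← min_sub_sub_right, mul_min_of_nonneg _ _ hd.le, ← mul_assoc,
              one_div_mul_cancel hn.ne']
            congr 1 <;> ring
          rw [Set.piecewise_eq_of_mem _ _ _ hx, Set.indicator_of_mem hx, this]
          ring
        · rw [Set.piecewise_eq_of_notMem _ _ _ hx, Set.indicator_of_notMem hx]
          ring
      simp only [e] at h
      rw [integral_const_mul, integral_indicator hE] at h
      by_contra! hcon
      exact absurd h (not_le.2 (mul_pos hd hcon))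
    · have h1 := abs_le.1 (hB x trivial)
      by_cases hx : x ∈ E
      · rw [Set.piecewise_eq_of_mem _ _ _ hx]
        have h2 : p x < t := hx.1
        refine abs_le.2 ⟨?_, (min_le_left _ _).trans (by linarith)⟩
        exact le_min (by linarith) (by linarith)
      · rw [Set.piecewise_eq_of_notMem _ _ _ hx]
        exact abs_le.2 ⟨by linarith, by linarith⟩
    · have h1 := hmono x y hxy
      by_cases hx : x ∈ E
      · have h2 : p x < t := hx.1
        rw [Set.piecewise_eq_of_mem _ _ _ hx]
        by_cases hy : y ∈ E
        · rw [Set.piecewise_eq_of_mem _ _ _ hy]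
          exact min_le_min_right _ (by linarith)
        · rw [Set.piecewise_eq_of_notMem _ _ _ hy]
          have hyt : t ≤ p y := not_lt.1 fun h => hy ⟨h, hUup x y hxy hx.2⟩
          exact (min_le_right _ _).trans hyt
      · rw [Set.piecewise_eq_of_notMem _ _ _ hx]
        by_cases hy : y ∈ E
        · rw [Set.piecewise_eq_of_mem _ _ _ hy]
          have h2 : p y < t := hy.1
          exact le_min (by linarith) (by linarith)
        · rwa [Set.piecewise_eq_of_notMem _ _ _ hy]
  have hfw : Continuous fun x => (f x - p x) * w x := by fun_prop
  have hlim := tendsto_integral_of_dominated_convergence (μ := (leb a b).restrict E)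
    (F := fun (n : ℕ) x => (f x - p x) * w x * min 1 ((n + 1) * (t - p x)))
    (f := fun x => (f x - p x) * w x) (fun x => |(f x - p x) * w x|)
    (fun n => (hfw.mul (by fun_prop)).aestronglyMeasurable)
    (integrable_leb_of_continuous hfw.abs).integrableOn ?_ ?_
  · exact le_of_tendsto' hlim key
  · intro n
    filter_upwards [ae_restrict_mem hE] with x hx
    have h2 : p x < t := hx.1
    rw [norm_mul, Real.norm_eq_abs, Real.norm_eq_abs]
    refine mul_le_of_le_one_right (abs_nonneg _) (abs_le.2 ⟨?_, min_le_left _ _⟩)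
    have : 0 ≤ ((n : ℝ) + 1) * (t - p x) := mul_nonneg (by positivity) (by linarith)
    exact le_min (by linarith) (by linarith)
  · filter_upwards [ae_restrict_mem hE] with x hx
    have h2 : 0 < t - p x := sub_pos.2 hx.1
    obtain ⟨N, hN⟩ := exists_nat_gt (1 / (t - p x))
    rw [div_lt_iff₀ h2] at hN
    refine tendsto_const_nhds.congr' ?_
    filter_upwards [eventually_ge_atTop N] with n hn
    have : (N : ℝ) ≤ n := by exact_mod_cast hn
    rw [min_eq_left (by nlinarith), mul_one]

/-- Negating `f`, `p`, `σ` and `t` exchanges lower and upper sets and reduces this to the previous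
inequality. -/
theorem setIntegral_lower_inter_upper_nonneg {f w p : Set.Icc a b → ℝ} (hf : Continuous f)
    (hw : Continuous w) (hp : Continuous p) (hmono : SigmaMonotonic σ p)
    (hVI : ∀ g : Set.Icc a b → ℝ, Measurable g → (∃ C, ∀ x, |g x| ≤ C) → SigmaMonotonic σ g →
      ∫ x, (f x - p x) * (g x - p x) * w x ∂leb a b ≤ 0)
    (t : ℝ) {L : Set (Set.Icc a b)} (hL : IsOpen L)
    (hLlow : ∀ y z : Set.Icc a b, SigmaLE σ y z → z ∈ L → y ∈ L) :
    0 ≤ ∫ x in L ∩ {x | t < p x}, (f x - p x) * w x ∂leb a b := by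
  have h := setIntegral_lower_inter_upper_nonpos (σ := -σ) hf.neg hw hp.neg
    (fun x y hxy => neg_le_neg (hmono y x (SigmaLE.neg_iff.1 hxy))) (fun g hg hgC hgm => ?_) (-t) hL
    (fun y z hyz => hLlow z y (SigmaLE.neg_iff.1 hyz))
  · have e : ∀ x, (-f x - -p x) * w x = -((f x - p x) * w x) := fun x => by ring
    simp only [Pi.neg_apply, neg_lt_neg_iff, e, integral_neg] at h
    rw [Set.inter_comm]
    linarith
  · obtain ⟨C, hC⟩ := hgC
    refine le_trans (le_of_eq ?_) (hVI (-g) hg.neg ⟨C, fun x => by simpa using hC x⟩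
      fun x y hxy => neg_le_neg (hgm y x (SigmaLE.neg_iff.2 hxy)))
    refine integral_congr_ae (ae_of_all _ fun x => ?_)
    simp only [Pi.neg_apply]
    ring

theorem setIntegral_leb_pos (hab : ∀ i, a i < b i) {w : Set.Icc a b → ℝ} (hw : Continuous w)
    (hw0 : ∀ x, 0 < w x) {E : Set (Set.Icc a b)} (hE : IsOpen E) (hne : E.Nonempty) :
    0 < ∫ x in E, w x ∂leb a b := by
  have := isOpenPosMeasure_leb hab
  rw [setIntegral_pos_iff_support_of_nonneg_ae (ae_of_all _ fun x => (hw0 x).le)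
    (integrable_leb_of_continuous hw).integrableOn]
  have : Function.support w = Set.univ := Set.eq_univ_of_forall fun x => (hw0 x).ne'
  rw [this, Set.univ_inter]
  exact hE.measure_pos _ hne

/-- The averaging formulas for a continuous regression. -/
theorem infSup_eq_and_eq_supInf (hab : ∀ i, a i < b i) {f w p : Set.Icc a b → ℝ}
    (hf : Continuous f) (hw : Continuous w) (hw0 : ∀ x, 0 < w x) (hp : Continuous p)
    (hmono : SigmaMonotonic σ p)
    (hVI : ∀ g : Set.Icc a b → ℝ, Measurable g → (∃ C, ∀ x, |g x| ≤ C) → SigmaMonotonic σ g →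
      ∫ x, (f x - p x) * (g x - p x) * w x ∂leb a b ≤ 0) (x : Set.Icc a b) :
    infSup σ f w x = (p x : EReal) ∧ (p x : EReal) = supInf σ f w x := by
  have hsplit : ∀ E : Set (Set.Icc a b), ∫ x in E, (f x - p x) * w x ∂leb a b =
      ∫ x in E, f x * w x ∂leb a b - ∫ x in E, p x * w x ∂leb a b := by
    intro E
    simp only [sub_mul]
    exact integral_sub (integrable_leb_of_continuous (hf.mul hw)).integrableOn
      (integrable_leb_of_continuous (hp.mul hw)).integrableOn
  -- This direction is the general minimax inequality; only the two outer bounds use the regression.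
  have hle : supInf σ f w x ≤ infSup σ f w x :=
    iSup₂_le fun U hU => le_iInf₂ fun L hL => (iInf₂_le L hL).trans
      (le_iSup₂ (f := fun U (_ : U ∈ upperRO σ x) => (wAverage f w (L ∩ U) : EReal)) U hU)
  have h1 : infSup σ f w x ≤ (p x : EReal) := by
    refine EReal.le_of_forall_lt_iff_le.1 fun t ht => ?_
    rw [EReal.coe_lt_coe_iff] at ht
    have ho : IsOpen {y | p y < t} := isOpen_lt hp continuous_const
    -- For `t > p x` the sublevel set is an admissible `L`. For every `U`, the average of `f` over
    -- `L ∩ U` is at most that of `p`, hence at most `t`.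
    refine iInf₂_le_of_le {y | p y < t} ⟨fun y z hyz hz => (hmono y z hyz).trans_lt hz, ho, ht⟩
      (iSup₂_le fun U hU => EReal.coe_le_coe_iff.2 ?_)
    rw [wAverage, div_le_iff₀ (setIntegral_leb_pos hab hw hw0 (ho.inter hU.2.1) ⟨x, ht, hU.2.2⟩)]
    have h2 := setIntegral_lower_inter_upper_nonpos hf hw hp hmono hVI t hU.2.1 hU.1
    rw [hsplit] at h2
    have h3 : ∫ y in {y | p y < t} ∩ U, p y * w y ∂leb a b ≤
        ∫ y in {y | p y < t} ∩ U, t * w y ∂leb a b :=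
      setIntegral_mono_on (integrable_leb_of_continuous (hp.mul hw)).integrableOn
        (integrable_leb_of_continuous (continuous_const.mul hw)).integrableOn
        (ho.inter hU.2.1).measurableSet
        fun y hy => mul_le_mul_of_nonneg_right (le_of_lt hy.1) (hw0 y).le
    rw [integral_const_mul] at h3
    linarith
  have h2 : (p x : EReal) ≤ supInf σ f w x := by
    refine EReal.ge_of_forall_gt_iff_ge.1 fun t ht => ?_
    rw [EReal.coe_lt_coe_iff] at ht
    have ho : IsOpen {y | t < p y} := isOpen_lt continuous_const hp
    refine le_iSup₂_of_le {y | t < p y} ⟨fun y z hyz hy => lt_of_lt_of_le hy (hmono y z hyz), ho, ht⟩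
      (le_iInf₂ fun L hL => EReal.coe_le_coe_iff.2 ?_)
    rw [wAverage, le_div_iff₀ (setIntegral_leb_pos hab hw hw0 (hL.2.1.inter ho) ⟨x, hL.2.2, ht⟩)]
    have h2 := setIntegral_lower_inter_upper_nonneg hf hw hp hmono hVI t hL.2.1 hL.1
    rw [hsplit] at h2
    have h3 : ∫ y in L ∩ {y | t < p y}, t * w y ∂leb a b ≤
        ∫ y in L ∩ {y | t < p y}, p y * w y ∂leb a b :=
      setIntegral_mono_on (integrable_leb_of_continuous (continuous_const.mul hw)).integrableOn
        (integrable_leb_of_continuous (hp.mul hw)).integrableOn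
        (hL.2.1.inter ho).measurableSet
        fun y hy => mul_le_mul_of_nonneg_right (le_of_lt hy.2) (hw0 y).le
    rw [integral_const_mul] at h3
    linarith
  exact ⟨le_antisymm h1 (h2.trans hle), le_antisymm h2 (hle.trans h1)⟩

end MonReg

namespace MonReg

/-! ### Functions on the cuboid as a subtype, and its fibres -/

section Extend

variable {ι : Type*} {a b : ι → ℝ}

open Classical in
/-- The extension by zero of a function on a cuboid. -/
noncomputable def extendBox (φ : Set.Icc a b → ℝ) (x : ι → ℝ) : ℝ :=
  if h : x ∈ Set.Icc a b then φ ⟨x, h⟩ else 0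

theorem extendBox_coe (φ : Set.Icc a b → ℝ) (x : Set.Icc a b) : extendBox φ x = φ x :=
  dif_pos x.2

theorem extendBox_of_mem (φ : Set.Icc a b → ℝ) {x : ι → ℝ} (hx : x ∈ Set.Icc a b) :
    extendBox φ x = φ ⟨x, hx⟩ :=
  dif_pos hx

theorem continuousOn_extendBox {φ : Set.Icc a b → ℝ} (hφ : Continuous φ) :
    ContinuousOn (extendBox φ) (Set.Icc a b) := by
  rw [continuousOn_iff_continuous_domRestrict]
  convert hφ using 1
  exact funext fun x => extendBox_coe φ x

end Extend

variable {ι : Type*} [Fintype ι] {σ : ι → SignType} {a b : ι → ℝ}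

theorem map_coe_leb (a b : ι → ℝ) :
    (leb a b).map Subtype.val = volume.restrict (Set.Icc a b) :=
  map_comap_subtype_coe measurableSet_Icc _

theorem measurableEmbedding_coe_Icc (a b : ι → ℝ) :
    MeasurableEmbedding (Subtype.val : Set.Icc a b → ι → ℝ) :=
  MeasurableEmbedding.subtype_coe measurableSet_Icc

theorem IsBoxRegression.integral_leb_nonpos {f w p g : Set.Icc a b → ℝ}
    (h : IsBoxRegression σ a b (extendBox f) (extendBox w) (extendBox p))
    (hgi : Integrable g (leb a b)) (hg : EssSigmaMonotonic σ (leb a b) g) :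
    ∫ x, (f x - p x) * (g x - p x) * w x ∂leb a b ≤ 0 := by
  have h1 : Integrable (extendBox g) (volume.restrict (Set.Icc a b)) := by
    rw [← map_coe_leb, (measurableEmbedding_coe_Icc a b).integrable_map_iff]
    exact hgi.congr (ae_of_all _ fun x => (extendBox_coe g x).symm)
  have h2 : EssMono σ (volume.restrict (Set.Icc a b)) (extendBox g) := by
    obtain ⟨N, hN, hmono⟩ := hg
    refine ⟨Subtype.val '' N ∪ (Set.Icc a b)ᶜ, ?_, fun x y hx hy hxy => ?_⟩
    · rw [← map_coe_leb, (measurableEmbedding_coe_Icc a b).map_apply]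
      convert hN using 2
      ext x
      simp
    · simp only [Set.mem_union, Set.mem_compl_iff, not_or, not_not] at hx hy
      rw [extendBox_of_mem g hx.2, extendBox_of_mem g hy.2]
      exact hmono _ _ (fun hh => hx.1 ⟨_, hh, rfl⟩) (fun hh => hy.1 ⟨_, hh, rfl⟩) hxy
  have h3 := h.integral_le _ h1 h2
  rw [← map_coe_leb, (measurableEmbedding_coe_Icc a b).integral_map] at h3
  simpa only [extendBox_coe] using h3

theorem IsBoxRegression.sigmaMonotonic {f w p : Set.Icc a b → ℝ}
    (h : IsBoxRegression σ a b (extendBox f) (extendBox w) (extendBox p)) :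
    SigmaMonotonic σ p := fun x y hxy => by
  simpa only [extendBox_coe] using h.mono x x.2 y y.2 hxy

theorem exists_continuous_regression (hab : ∀ i, a i < b i) (σ : ι → SignType)
    {f w : Set.Icc a b → ℝ} (hf : Continuous f) (hw : Continuous w) (hw0 : ∀ x, 0 < w x) :
    ∃ p : Set.Icc a b → ℝ, Continuous p ∧
      IsBoxRegression σ a b (extendBox f) (extendBox w) (extendBox p) := by
  obtain ⟨p, hp, h⟩ := exists_continuousOn_boxRegression hab σ (continuousOn_extendBox hf)
    (continuousOn_extendBox hw) fun x hx => by
      rw [extendBox_of_mem w hx]; exact hw0 _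
  have hcont : Continuous ((Set.Icc a b).domRestrict p) := continuousOn_iff_continuous_domRestrict.1 hp
  have e : ∀ x ∈ Set.Icc a b, extendBox ((Set.Icc a b).domRestrict p) x = p x := fun x hx =>
    extendBox_of_mem _ hx
  refine ⟨(Set.Icc a b).domRestrict p, hcont, fun x hx y hy hxy => ?_,
    memLp_top_of_continuousOn (continuousOn_extendBox hcont), fun g hgi hg => ?_⟩
  · rw [e x hx, e y hy]
    exact h.mono x hx y hy hxy
  · rw [setIntegral_congr_fun measurableSet_Icc (g := fun x =>
      (extendBox f x - p x) * (g x - p x) * extendBox w x) fun x hx => by simp only [e x hx]]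
    exact h.integral_le g hgi hg

/-- Continuity makes the exceptional set open, and nonempty open sets are not null, so the a.e.
estimate holds everywhere. -/
theorem IsBoxRegression.le_add_of_close (hab : ∀ i, a i < b i)
    {f w p f' w' q : Set.Icc a b → ℝ} {C m δ δ' η : ℝ}
    (hp : IsBoxRegression σ a b (extendBox f) (extendBox w) (extendBox p))
    (hq : IsBoxRegression σ a b (extendBox f') (extendBox w') (extendBox q))
    (hpc : Continuous p) (hqc : Continuous q)
    (hf : Continuous f) (hw : Continuous w) (hf' : Continuous f') (hw' : Continuous w')
    (hm : 0 < m) (hwm : ∀ x, m ≤ w x) (hw0 : ∀ x, 0 < w' x) (hfC : ∀ x, |f' x| ≤ C)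
    (hff : ∀ x, |f x - f' x| ≤ δ) (hww : ∀ x, |w x - w' x| ≤ δ')
    (hδη : δ ≤ η) (hη : 2 * C * δ' ≤ m * (η - δ)) (x : Set.Icc a b) : p x ≤ q x + η := by
  have h := hp.ae_le_add_of_close hq (memLp_top_of_continuousOn (continuousOn_extendBox hf))
    (memLp_top_of_continuousOn (continuousOn_extendBox hw))
    (memLp_top_of_continuousOn (continuousOn_extendBox hf'))
    (memLp_top_of_continuousOn (continuousOn_extendBox hw')) hm
    (fun x hx => by simpa only [extendBox_of_mem _ hx] using hwm ⟨x, hx⟩)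
    (fun x hx => by simpa only [extendBox_of_mem _ hx] using hw0 ⟨x, hx⟩)
    (fun x hx => by simpa only [extendBox_of_mem _ hx] using hfC ⟨x, hx⟩)
    (fun x hx => by simpa only [extendBox_of_mem _ hx] using hff ⟨x, hx⟩)
    (fun x hx => by simpa only [extendBox_of_mem _ hx] using hww ⟨x, hx⟩) hδη hη
  rw [← map_coe_leb, (measurableEmbedding_coe_Icc a b).ae_map_iff] at h
  simp only [extendBox_coe] at h
  have := isOpenPosMeasure_leb hab
  by_contra! hcon
  have ho : IsOpen {y | q y + η < p y} := isOpen_lt (by fun_prop) hpc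
  exact (ho.measure_pos (leb a b) ⟨x, hcon⟩).ne'
    (by simpa only [ae_iff, not_le] using h)

/-! ### Splitting the cuboid into monotone and remaining coordinates -/

section Fibre

variable {ι : Type*} {a b : ι → ℝ} (σ : ι → SignType)

theorem join_dotPart_hatPart (x : Set.Icc a b) : join σ (hatPart σ x) (dotPart σ x) = x := by
  refine Subtype.ext (funext fun i => ?_)
  simp [join, hatPart, dotPart]

theorem hatPart_join (y : hatQ σ a b) (z : dotQ σ a b) : hatPart σ (join σ y z) = y :=
  Subtype.ext (funext fun i => dif_neg i.2)

theorem dotPart_join (y : hatQ σ a b) (z : dotQ σ a b) : dotPart σ (join σ y z) = z :=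
  Subtype.ext (funext fun i => dif_pos i.2)

theorem continuous_hatPart : Continuous (hatPart σ : Set.Icc a b → hatQ σ a b) := by
  exact Continuous.subtype_mk
    (continuous_pi fun i => (continuous_apply i.1).comp continuous_subtype_val) _

theorem continuous_dotPart : Continuous (dotPart σ : Set.Icc a b → dotQ σ a b) := by
  exact Continuous.subtype_mk
    (continuous_pi fun i => (continuous_apply i.1).comp continuous_subtype_val) _

theorem continuous_join :
    Continuous fun zy : dotQ σ a b × hatQ σ a b => join σ zy.2 zy.1 := by
  refine Continuous.subtype_mk (continuous_pi fun i => ?_) _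
  by_cases h : σ i = 0
  · simp only [h, dif_pos]
    exact (continuous_apply _).comp (continuous_subtype_val.comp continuous_fst)
  · simp only [h, dif_neg, not_false_eq_true]
    exact (continuous_apply _).comp (continuous_subtype_val.comp continuous_snd)

theorem sigmaLE_join {y y' : hatQ σ a b} (z : dotQ σ a b)
    (h : SigmaLE (hatSign σ) (y : HatIdx σ → ℝ) y') :
    SigmaLE σ (join σ y z : ι → ℝ) (join σ y' z) := by
  intro i
  by_cases hi : σ i = 0
  · simp [join, hi]
  · simpa [join, hi, hatSign] using (h ⟨i, hi⟩).1 hi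

theorem sigmaLE_hatPart {x y : Set.Icc a b} (h : SigmaLE σ (x : ι → ℝ) y) :
    SigmaLE (hatSign σ) (hatPart σ x : HatIdx σ → ℝ) (hatPart σ y) := fun i => h i

theorem dotPart_eq_of_sigmaLE {x y : Set.Icc a b} (h : SigmaLE σ (x : ι → ℝ) y) :
    dotPart σ x = dotPart σ y :=
  Subtype.ext (funext fun i => (h i).2 i.2)

/-- The decomposition of the cuboid into the remaining and the monotone coordinates. -/
def splitEquiv [Fintype ι] (a b : ι → ℝ) : Set.Icc a b ≃ᵐ dotQ σ a b × hatQ σ a b where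
  toFun x := (dotPart σ x, hatPart σ x)
  invFun zy := join σ zy.2 zy.1
  left_inv x := join_dotPart_hatPart σ x
  right_inv zy := by simp [hatPart_join, dotPart_join]
  measurable_toFun := ((continuous_dotPart σ).prodMk (continuous_hatPart σ)).measurable
  measurable_invFun := (continuous_join σ).measurable

theorem measurePreserving_splitEquiv [Fintype ι] (a b : ι → ℝ) :
    MeasurePreserving (splitEquiv σ a b) (leb a b)
      ((leb (fun i : DotIdx σ => a i) (fun i : DotIdx σ => b i)).prod
        (leb (fun i : HatIdx σ => a i) (fun i : HatIdx σ => b i))) := by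
  classical
  refine ⟨(splitEquiv σ a b).measurable, (Measure.prod_eq fun s t hs ht => ?_).symm⟩
  rw [MeasurableEquiv.map_apply, leb, leb, leb, comap_subtype_coe_apply measurableSet_Icc,
    comap_subtype_coe_apply measurableSet_Icc, comap_subtype_coe_apply measurableSet_Icc,
    ← Measure.prod_prod, ← Measure.volume_eq_prod,
    ← (volume_preserving_piEquivPiSubtypeProd (fun _ : ι => ℝ) fun i => σ i = 0).measure_preimage_equiv]
  congr 1
  ext x
  constructor
  · rintro ⟨y, hy, rfl⟩
    exact ⟨⟨_, hy.1, rfl⟩, ⟨_, hy.2, rfl⟩⟩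
  · rintro ⟨⟨z, hz, hzx⟩, ⟨y, hy, hyx⟩⟩
    refine ⟨join σ y z, ⟨?_, ?_⟩, ?_⟩
    · show dotPart σ (join σ y z) ∈ s
      rwa [dotPart_join]
    · show hatPart σ (join σ y z) ∈ t
      rwa [hatPart_join]
    · funext i
      by_cases h : σ i = 0
      · simpa [join, h] using congrFun hzx ⟨i, h⟩
      · simpa [join, h] using congrFun hyx ⟨i, h⟩

end Fibre

end MonReg

namespace MonReg

/-! ### The regression on the whole cuboid -/

section Family

variable {ι : Type*} [Fintype ι] {a b : ι → ℝ} {σ : ι → SignType}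

-- By compactness, `F` and `W` are uniformly continuous and `W` has a positive minimum. The
-- stability estimate, applied in both directions, then makes the fibre regressions depend
-- continuously on `z` in the sup norm.
open Filter Topology in
theorem eventually_forall_abs_sub_regression_le {Z : Type*} [PseudoMetricSpace Z] [CompactSpace Z]
    (hab : ∀ i, a i < b i) {F W : Z × Set.Icc a b → ℝ} (hF : Continuous F) (hW : Continuous W)
    (hW0 : ∀ v, 0 < W v) {p : Z → Set.Icc a b → ℝ} (hpc : ∀ z, Continuous (p z))
    (hp : ∀ z, IsBoxRegression σ a b (extendBox fun y => F (z, y)) (extendBox fun y => W (z, y))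
      (extendBox (p z))) (z : Z) {η : ℝ} (hη : 0 < η) :
    ∀ᶠ z' in 𝓝 z, ∀ y, |p z' y - p z y| ≤ η := by
  obtain ⟨C, hC⟩ := isCompact_univ.exists_bound_of_continuousOn hF.continuousOn
  obtain ⟨v, -, hmin⟩ := isCompact_univ.exists_isMinOn
    ⟨(z, ⟨a, le_rfl, fun i => (hab i).le⟩), trivial⟩ hW.continuousOn
  have hC0 : 0 ≤ C := (norm_nonneg _).trans (hC v trivial)
  have hm := hW0 v
  set m := W v
  have hε : 0 < m * η / (4 * (C + 1)) := by positivity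
  obtain ⟨δ₁, hδ₁, h₁⟩ := Metric.uniformContinuous_iff.1
    (CompactSpace.uniformContinuous_of_continuous hF) (η / 2) (by positivity)
  obtain ⟨δ₂, hδ₂, h₂⟩ := Metric.uniformContinuous_iff.1
    (CompactSpace.uniformContinuous_of_continuous hW) _ hε
  have harith : 2 * C * (m * η / (4 * (C + 1))) ≤ m * (η - η / 2) := by
    have : m * (η - η / 2) - 2 * C * (m * η / (4 * (C + 1))) = m * η / (2 * (C + 1)) := by
      field_simp
      ring
    have : 0 ≤ m * η / (2 * (C + 1)) := by positivity
    linarith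
  filter_upwards [Metric.ball_mem_nhds z hδ₁, Metric.ball_mem_nhds z hδ₂] with z' hz₁ hz₂ y
  have hFc : ∀ z, Continuous fun y => F (z, y) := fun z => by fun_prop
  have hWc : ∀ z, Continuous fun y => W (z, y) := fun z => by fun_prop
  have hd : ∀ y : Set.Icc a b, dist (z', y) (z, y) = dist z' z := fun y => by
    simp [Prod.dist_eq]
  have hFd : ∀ y, |F (z', y) - F (z, y)| ≤ η / 2 := fun y =>
    (h₁ (by rw [hd]; exact hz₁)).le
  have hWd : ∀ y, |W (z', y) - W (z, y)| ≤ m * η / (4 * (C + 1)) := fun y =>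
    (h₂ (by rw [hd]; exact hz₂)).le
  have e1 := (hp z').le_add_of_close hab (hp z) (hpc z') (hpc z) (hFc z') (hWc z') (hFc z) (hWc z)
    hm (fun y => hmin (Set.mem_univ _)) (fun y => hW0 _) (fun y => hC _ (Set.mem_univ _)) hFd hWd
    (by linarith) harith y
  have e2 := (hp z).le_add_of_close hab (hp z') (hpc z) (hpc z') (hFc z) (hWc z) (hFc z') (hWc z')
    hm (fun y => hmin (Set.mem_univ _)) (fun y => hW0 _) (fun y => hC _ (Set.mem_univ _))
    (fun y => abs_sub_comm (F (z', y)) (F (z, y)) ▸ hFd y)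
    (fun y => abs_sub_comm (W (z', y)) (W (z, y)) ▸ hWd y) (by linarith) harith y
  exact abs_le.2 ⟨by linarith, by linarith⟩

open Filter Topology in
theorem continuous_uncurry_of_eventually_close {Z Y : Type*} [TopologicalSpace Z]
    [TopologicalSpace Y] {p : Z → Y → ℝ} (hpc : ∀ z, Continuous (p z))
    (h : ∀ z, ∀ η > 0, ∀ᶠ z' in 𝓝 z, ∀ y, |p z' y - p z y| ≤ η) :
    Continuous fun v : Z × Y => p v.1 v.2 := by
  refine continuous_iff_continuousAt.2 fun ⟨z, y⟩ => Metric.tendsto_nhds.2 fun ε hε => ?_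
  rw [nhds_prod_eq]
  filter_upwards [(h z (ε / 2) (half_pos hε)).prod_mk
    (Metric.tendsto_nhds.1 (hpc z).continuousAt (ε / 2) (half_pos hε))] with ⟨z', y'⟩ hv
  have h1 := abs_le.1 (hv.1 y')
  have h2 := abs_lt.1 hv.2
  rw [Real.dist_eq, abs_lt]
  constructor <;> simp only at h1 h2 ⊢ <;> linarith

/-- By Fubini, almost every fibre of `g` is integrable and monotonic off a null set, so the inner
integral is nonpositive by the regression property of that fibre. -/
theorem integral_fibrewise_nonpos (σ : ι → SignType) {f w p g : Set.Icc a b → ℝ}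
    (hf : Continuous f) (hw : Continuous w) (hp : Continuous p)
    (hreg : ∀ z : dotQ σ a b, IsBoxRegression (hatSign σ) (fun i => a i) (fun i => b i)
      (extendBox fun y : hatQ σ a b => f (join σ y z))
      (extendBox fun y : hatQ σ a b => w (join σ y z))
      (extendBox fun y : hatQ σ a b => p (join σ y z)))
    (hgi : Integrable g (leb a b)) (hg : EssSigmaMonotonic σ (leb a b) g) :
    ∫ x, (f x - p x) * (g x - p x) * w x ∂leb a b ≤ 0 := by
  have hmp := (measurePreserving_splitEquiv σ a b).symm
  have hH : Integrable (fun x => (f x - p x) * (g x - p x) * w x) (leb a b) := by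
    obtain ⟨C, hC⟩ := isCompact_univ.exists_bound_of_continuousOn
      (show Continuous fun x => (f x - p x) * w x by fun_prop).continuousOn
    refine ((hgi.sub (integrable_leb_of_continuous hp)).bdd_mul (c := C)
      (show Continuous fun x => (f x - p x) * w x by fun_prop).aestronglyMeasurable
      (ae_of_all _ fun x => hC x trivial)).congr (ae_of_all _ fun x => ?_)
    simp only [Pi.sub_apply]
    ring
  have hH' := hmp.integrable_comp_of_integrable hH
  rw [Function.comp_def] at hH'
  rw [← hmp.integral_comp (splitEquiv σ a b).symm.measurableEmbedding, integral_prod _ hH']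
  obtain ⟨N, hN, hmono⟩ := hg
  have hN' : ∀ᵐ v ∂((leb (fun i : DotIdx σ => a i) (fun i : DotIdx σ => b i)).prod
      (leb (fun i : HatIdx σ => a i) (fun i : HatIdx σ => b i))),
      (splitEquiv σ a b).symm v ∉ N :=
    compl_mem_ae_iff.2 (hmp.quasiMeasurePreserving.preimage_null hN)
  refine integral_nonpos_of_ae ?_
  filter_upwards [Measure.ae_ae_of_ae_prod hN',
    (hmp.integrable_comp_of_integrable hgi).prod_right_ae] with z hz hgz
  exact (hreg z).integral_leb_nonpos hgz ⟨{y | join σ y z ∈ N}, by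
      simpa only [ae_iff, not_not] using! hz,
    fun y y' hy hy' hyy => hmono _ _ hy hy' (sigmaLE_join σ z hyy)⟩

/-- Existence of the continuous regression on the whole cuboid, fibre by fibre. -/
theorem exists_fibrewise_regression (hab : ∀ i, a i < b i) (σ : ι → SignType)
    {f w : Set.Icc a b → ℝ} (hf : Continuous f) (hw : Continuous w) (hw0 : ∀ x, 0 < w x) :
    ∃ p : Set.Icc a b → ℝ, Continuous p ∧ SigmaMonotonic σ p ∧
      ∀ z : dotQ σ a b, IsBoxRegression (hatSign σ) (fun i => a i) (fun i => b i)
        (extendBox fun y : hatQ σ a b => f (join σ y z))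
        (extendBox fun y : hatQ σ a b => w (join σ y z))
        (extendBox fun y : hatQ σ a b => p (join σ y z)) := by
  have hab' : ∀ i : HatIdx σ, a i < b i := fun i => hab i
  have hF : Continuous fun v : dotQ σ a b × hatQ σ a b => f (join σ v.2 v.1) :=
    hf.comp (continuous_join σ)
  have hW : Continuous fun v : dotQ σ a b × hatQ σ a b => w (join σ v.2 v.1) :=
    hw.comp (continuous_join σ)
  choose p hpc hp using fun z : dotQ σ a b =>
    exists_continuous_regression hab' (hatSign σ)
      (hF.comp (Continuous.prodMk_right z)) (hW.comp (Continuous.prodMk_right z))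
      (fun y => hw0 _)
  have hcont := continuous_uncurry_of_eventually_close hpc fun z η hη =>
    eventually_forall_abs_sub_regression_le hab' hF hW (fun v => hw0 _) hpc hp z hη
  refine ⟨fun x => p (dotPart σ x) (hatPart σ x),
    hcont.comp ((continuous_dotPart σ).prodMk (continuous_hatPart σ)), fun x y hxy => ?_,
    fun z => ?_⟩
  -- Comparable points lie in the same fibre, so monotonicity on each fibre is enough.
  · simp only [dotPart_eq_of_sigmaLE σ hxy]
    exact (hp _).sigmaMonotonic _ _ (sigmaLE_hatPart σ hxy)
  · simp only [dotPart_join, hatPart_join]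
    exact hp z

end Family

/-- The obtuse angle at `p` gives `‖F - p‖² + ‖g - p‖² ≤ ‖F - g‖²`, which contains minimality and
uniqueness at once. -/
theorem isSigmaRegression_iff_of_inner_nonpos {ι : Type*} {σ : ι → SignType}
    {a b : ι → ℝ} {μ : Measure (Set.Icc a b)} {F p : Lp ℝ 2 μ}
    (hp : p ∈ sigmaL2 σ μ) (h : ∀ g ∈ sigmaL2 σ μ, inner ℝ (F - p) (g - p) ≤ 0)
    (q : Lp ℝ 2 μ) : IsSigmaRegression σ μ F q ↔ q = p := by
  have key : ∀ g ∈ sigmaL2 σ μ, ‖F - p‖ ^ 2 + ‖g - p‖ ^ 2 ≤ ‖F - g‖ ^ 2 := by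
    intro g hg
    have h1 := norm_sub_sq_real (F - p) (g - p)
    rw [sub_sub_sub_cancel_right] at h1
    linarith [h g hg]
  constructor
  · rintro ⟨hq, hmin⟩
    have h1 := key q hq
    have h2 := pow_le_pow_left₀ (norm_nonneg _) (hmin p hp) 2
    have h3 : ‖q - p‖ ^ 2 = 0 := le_antisymm (by linarith) (sq_nonneg _)
    exact sub_eq_zero.1 (norm_eq_zero.1 (pow_eq_zero_iff two_ne_zero |>.1 h3))
  · rintro rfl
    refine ⟨hp, fun g hg => ?_⟩
    refine le_of_sq_le_sq ?_ (norm_nonneg _)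
    linarith [key g hg, sq_nonneg ‖g - q‖]

/-! ### Passing between Lebesgue measure and `w · λ` -/

section WeightedVolume

variable {ι : Type*} [Fintype ι] {a b : ι → ℝ} {w : Set.Icc a b → ℝ}

theorem isFiniteMeasure_weightedVolume (hw : Continuous w) :
    IsFiniteMeasure (weightedVolume w) :=
  isFiniteMeasure_withDensity_ofReal (integrable_leb_of_continuous hw).2

theorem leb_absolutelyContinuous_weightedVolume (hw : Continuous w) (hw0 : ∀ x, 0 < w x) :
    leb a b ≪ weightedVolume w :=
  withDensity_absolutelyContinuous' hw.measurable.ennreal_ofReal.aemeasurable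
    (ae_of_all _ fun x => (ENNReal.ofReal_pos.2 (hw0 x)).ne')

theorem integral_weightedVolume (hw : Continuous w) (hw0 : ∀ x, 0 < w x)
    (g : Set.Icc a b → ℝ) :
    ∫ x, g x ∂weightedVolume w = ∫ x, g x * w x ∂leb a b := by
  rw [weightedVolume, integral_withDensity_eq_integral_toReal_smul
    hw.measurable.ennreal_ofReal (ae_of_all _ fun x => ENNReal.ofReal_lt_top)]
  refine integral_congr_ae (ae_of_all _ fun x => ?_)
  simp only [ENNReal.toReal_ofReal (hw0 x).le, smul_eq_mul]
  ring

theorem integrable_leb_of_integrable_weightedVolume (hw : Continuous w) (hw0 : ∀ x, 0 < w x)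
    {g : Set.Icc a b → ℝ} (hg : Integrable g (weightedVolume w)) : Integrable g (leb a b) := by
  rw [weightedVolume, integrable_withDensity_iff_integrable_smul' hw.measurable.ennreal_ofReal
    (ae_of_all _ fun x => ENNReal.ofReal_lt_top)] at hg
  have hc : Continuous fun x => (w x)⁻¹ := hw.inv₀ fun x => (hw0 x).ne'
  obtain ⟨C, hC⟩ := isCompact_univ.exists_bound_of_continuousOn hc.continuousOn
  refine (hg.bdd_mul (c := C) hc.aestronglyMeasurable (ae_of_all _ fun x => hC x trivial)).congr
    (ae_of_all _ fun x => ?_)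
  simp only [ENNReal.toReal_ofReal (hw0 x).le, smul_eq_mul]
  rw [← mul_assoc, inv_mul_cancel₀ (hw0 x).ne', one_mul]

end WeightedVolume

end MonReg

/-! ### The regression in `L²` and its averaging formulas -/

theorem theorem6p3 (d : ℕ) (a b : Fin d → ℝ) (hab : ∀ i, a i < b i)
    (σ : Fin d → SignType) (f w : Set.Icc a b → ℝ)
    (hf : Continuous f) (hw : Continuous w) (hw_pos : ∀ x, 0 < w x) :
    ∃ p : Lp ℝ 2 (MonReg.weightedVolume w),
      -- `p` is the one and only regression of `f`
      (∀ q : Lp ℝ 2 (MonReg.weightedVolume w),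
        MonReg.IsSigmaRegression σ (MonReg.weightedVolume w)
          ((MonReg.memLp_weightedVolume hf hw).toLp f) q ↔ q = p) ∧
      ∃ f₀ : Set.Icc a b → ℝ,
        -- `f₀` is the one and only continuous monotonic representative of `p`
        (∀ g : Set.Icc a b → ℝ,
          (Continuous g ∧ MonReg.SigmaMonotonic σ g ∧
            p =ᵐ[MonReg.weightedVolume w] g) ↔ g = f₀) ∧
        -- the averaging formulas
        ∀ x : Set.Icc a b,
          MonReg.infSup (MonReg.hatSign σ)
              (fun y => f (MonReg.join σ y (MonReg.dotPart σ x)))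
              (fun y => w (MonReg.join σ y (MonReg.dotPart σ x)))
              (MonReg.hatPart σ x) = (f₀ x : EReal) ∧
          (f₀ x : EReal) =
            MonReg.supInf (MonReg.hatSign σ)
              (fun y => f (MonReg.join σ y (MonReg.dotPart σ x)))
              (fun y => w (MonReg.join σ y (MonReg.dotPart σ x)))
              (MonReg.hatPart σ x) := by
  obtain ⟨f₀, hc, hmono, hreg⟩ := MonReg.exists_fibrewise_regression hab σ hf hw hw_pos
  have hfin := MonReg.isFiniteMeasure_weightedVolume hw
  have hac := MonReg.leb_absolutelyContinuous_weightedVolume hw hw_pos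
  have hpos := MonReg.isOpenPosMeasure_leb hab
  have hrep := (MonReg.memLp_weightedVolume hc hw).coeFn_toLp
  have hFrep := (MonReg.memLp_weightedVolume hf hw).coeFn_toLp
  refine ⟨(MonReg.memLp_weightedVolume hc hw).toLp f₀, fun q =>
    MonReg.isSigmaRegression_iff_of_inner_nonpos ?_ (fun g hg => ?_) q, f₀, fun g =>
    ⟨fun ⟨hgc, _, hg⟩ => ?_, ?_⟩, fun x => ?_⟩
  · refine ⟨_, ae_iff.1 hrep, fun x y hx hy hxy => ?_⟩
    simp only [Set.mem_ofPred_eq, not_not] at hx hy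
    rw [hx, hy]
    exact hmono x y hxy
  · rw [L2.inner_def]
    have h := MonReg.integral_fibrewise_nonpos σ hf hw hc hreg
      (MonReg.integrable_leb_of_integrable_weightedVolume hw hw_pos
        ((Lp.memLp g).integrable one_le_two))
      (by
        obtain ⟨N, hN, hgN⟩ := hg
        exact ⟨N, hac hN, hgN⟩)
    rw [← MonReg.integral_weightedVolume hw hw_pos] at h
    refine le_trans (le_of_eq (integral_congr_ae ?_)) h
    filter_upwards [hrep, hFrep, Lp.coeFn_sub ((MonReg.memLp_weightedVolume hf hw).toLp f)
      ((MonReg.memLp_weightedVolume hc hw).toLp f₀),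
      Lp.coeFn_sub g ((MonReg.memLp_weightedVolume hc hw).toLp f₀)] with x h1 h2 h3 h4
    rw [h3, h4]
    simp only [Pi.sub_apply, h1, h2, RCLike.inner_apply, conj_trivial]
    ring
  -- Positivity of `w` makes the a.e. equality hold for Lebesgue measure, which charges all nonempty
  -- open sets; continuous functions that agree a.e. are then equal.
  · exact (Continuous.ae_eq_iff_eq (MonReg.leb a b) hgc hc).1
      (hac.ae_eq (hg.symm.trans hrep))
  · rintro rfl
    exact ⟨hc, hmono, hrep⟩
  -- The formulas are those of the fibre through `x`, where the restriction of `f₀` is itself a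
  -- regression.
  · have h := MonReg.infSup_eq_and_eq_supInf (σ := MonReg.hatSign σ)
      (a := fun i : MonReg.HatIdx σ => a i) (b := fun i : MonReg.HatIdx σ => b i)
      (fun i => hab i)
      (f := fun y => f (MonReg.join σ y (MonReg.dotPart σ x)))
      (w := fun y => w (MonReg.join σ y (MonReg.dotPart σ x)))
      (p := fun y => f₀ (MonReg.join σ y (MonReg.dotPart σ x)))
      (hf.comp ((MonReg.continuous_join σ).comp (Continuous.prodMk_right _)))
      (hw.comp ((MonReg.continuous_join σ).comp (Continuous.prodMk_right _)))
      (fun y => hw_pos _)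
      (hc.comp ((MonReg.continuous_join σ).comp (Continuous.prodMk_right _)))
      (hreg _).sigmaMonotonic
      (fun g hg ⟨C, hC⟩ hgm => (hreg _).integral_leb_nonpos
        (Integrable.of_bound hg.aestronglyMeasurable C (ae_of_all _ hC))
        ⟨∅, measure_empty, fun y z _ _ hyz => hgm y z hyz⟩)
      (MonReg.hatPart σ x)
    simpa only [MonReg.join_dotPart_hatPart] using h
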